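/- Let $L\ge 2$, let $d_0,\dots,d_L$ be positive integers, $\lambda_1,\dots,\lambda_L>0$, $Y\in\mathbb R^{d_L\times d_0}$, and for $W=(W_1,\dots,W_L)$ with $W_l\in\mathbb R^{d_l\times d_{l-1}}$ let $$F(W)=\|W_L\cdots W_1-Y\|_F^2+\sum_{l=1}^L\lambda_l\|W_l\|_F^2 .$$ Put $\lambda=\prod_{l=1}^L\lambda_l$, $d_Y=\min\{d_0,d_L\}$, $d_{\min}=\min\{d_0,\dots,d_L\}$ and $r_Y=\operatorname{rank}Y$. Write $\mathcal O^n$ for the set of orthogonal $n\times n$ matrices and $\mathrm{BlkD}$ for block-diagonal matrices (blocks with zero rows or columns are allowed). Let $Y=U_Y\Sigma_YV_Y^T$ be any singular value decomposition, with $U_Y\in\mathcal O^{d_L}$, $V_Y\in\mathcal O^{d_0}$, $\Sigma_Y=\mathrm{BlkD}(\mathrm{diag}(y_1,\dots,y_{d_Y}),0)\in\mathbb R^{d_L\times d_0}$ and $y_1\ge\dots\ge y_{d_Y}\ge0$. Let $p_Y$ be the number of distinct positive values among the $y_i$, and let $0=s_0<s_1<\dots<s_{p_Y}=r_Y$ be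 the indices with $$y_{s_0+1}=\dots=y_{s_1}>y_{s_1+1}=\dots=y_{s_2}>\dots>y_{s_{p_Y-1}+1}=\dots=y_{s_{p_Y}}>0,\qquad y_{s_{p_Y}+1}=\dots=y_{d_Y}=0,$$ and $h_i=s_i-s_{i-1}$ for $i=1,\dots,p_Y$. Then $\nabla F(W)=0$ if and only if there are * $Q_l\in\mathcal O^{d_{l-1}}$ for $l=2,\dots,L$, * $O_i\in\mathcal O^{h_i}$ for $i=1,\dots,p_Y$, $O_{p_Y+1}\in\mathcal O^{d_0-r_Y}$ and $\widehat O_{p_Y+1}\in\mathcal O^{d_L-r_Y}$, * a vector $\sigma\in\mathbb R^{d_{\min}}$ and a permutation $\pi$ of $\{1,\dots,d_Y\}$, with permutation matrix $\Pi$ given by $\Pi(i,j)=1$ if $j=\pi(i)$ and $\Pi(i,j)=0$ otherwise, such that $$\sigma_i^{2L-1}-\sqrt{\lambda}\,y_{\pi(i)}\,\sigma_i^{L-1}+\lambda\sigma_i=0\quad(1\le i\le d_{\min}),\qquad \sigma_1\ge\sigma_2\ge\dots\ge\sigma_{d_{\min}}\ge0,$$ and, with $\Sigma_l=\mathrm{BlkD}(\mathrm{diag}(\sigma)/\sqrt{\lambda_l},0)\in\mathbb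 R^{d_l\times d_{l-1}}$ for $l=1,\dots,L$, $$\begin{aligned} W_1&=Q_2\,\Sigma_1\,\mathrm{BlkD}(\Pi,I)\,\mathrm{BlkD}(O_1,\dots,O_{p_Y},O_{p_Y+1})\,V_Y^T,\\ W_l&=Q_{l+1}\,\Sigma_l\,Q_l^T\qquad(2\le l\le L-1),\\ W_L&=U_Y\,\mathrm{BlkD}(O_1^T,\dots,O_{p_Y}^T,\widehat O_{p_Y+1}^T)\,\mathrm{BlkD}(\Pi^T,I)\,\Sigma_L\,Q_L^T . \end{aligned}$$ -/

import Mathlib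

open Matrix

/- Matrices carry the Frobenius norm, so that `‖A‖` is `‖A‖_F`. -/
attribute [local instance] Matrix.frobeniusNormedAddCommGroup
attribute [local instance] Matrix.frobeniusNormedSpace

namespace DMF

/-- The tuples `(W_1, …, W_L)` of weight matrices for the widths `d_0, …, d_L`.
For `l : Fin L`, the entry `W l` is `W_{l+1} ∈ ℝ^{d_{l+1} × d_l}`. -/
abbrev Weights {L : ℕ} (d : Fin (L + 1) → ℕ) : Type :=
  (l : Fin L) → Matrix (Fin (d l.succ)) (Fin (d l.castSucc)) ℝ

/-- The partial product `W_k ⋯ W_1 ∈ ℝ^{d_k × d_0}` (the identity for `k = 0`). -/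
def partialProd {L : ℕ} {d : Fin (L + 1) → ℕ} (W : Weights d) (k : Fin (L + 1)) :
    Matrix (Fin (d k)) (Fin (d 0)) ℝ :=
  Fin.induction (motive := fun k => Matrix (Fin (d k)) (Fin (d 0)) ℝ)
    (1 : Matrix (Fin (d 0)) (Fin (d 0)) ℝ) (fun l P => W l * P) k

/-- The regularized loss `F(W) = ‖W_L ⋯ W_1 - Y‖_F² + ∑_l λ_l ‖W_l‖_F²`. -/
noncomputable def loss {L : ℕ} {d : Fin (L + 1) → ℕ} (lam : Fin L → ℝ)
    (Y : Matrix (Fin (d (Fin.last L))) (Fin (d 0)) ℝ) (W : Weights d) : ℝ :=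
  ‖partialProd W (Fin.last L) - Y‖ ^ 2 + ∑ l, lam l * ‖W l‖ ^ 2

/-- `W` is a critical point of the loss: `F` is differentiable at `W` with `∇F(W) = 0`. -/
def IsCriticalPoint {L : ℕ} {d : Fin (L + 1) → ℕ} (lam : Fin L → ℝ)
    (Y : Matrix (Fin (d (Fin.last L))) (Fin (d 0)) ℝ) (W : Weights d) : Prop :=
  HasFDerivAt (𝕜 := ℝ) (loss lam Y) 0 W

/-- `d_Y = min {d_0, d_L}`. -/
def dY {L : ℕ} (d : Fin (L + 1) → ℕ) : ℕ := min (d 0) (d (Fin.last L))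

/-- `d_min = min {d_0, d_1, …, d_L}`. -/
def dMin {L : ℕ} (d : Fin (L + 1) → ℕ) : ℕ :=
  Finset.univ.inf' ⟨0, Finset.mem_univ 0⟩ d

theorem dMin_le {L : ℕ} (d : Fin (L + 1) → ℕ) (k : Fin (L + 1)) : dMin d ≤ d k :=
  Finset.inf'_le d (Finset.mem_univ k)

theorem dY_le_zero {L : ℕ} (d : Fin (L + 1) → ℕ) : dY d ≤ d 0 := min_le_left _ _

theorem dY_le_last {L : ℕ} (d : Fin (L + 1) → ℕ) : dY d ≤ d (Fin.last L) := min_le_right _ _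

theorem dMin_le_dY {L : ℕ} (d : Fin (L + 1) → ℕ) : dMin d ≤ dY d :=
  le_min (dMin_le d 0) (dMin_le d (Fin.last L))

/-- The first `a` and the remaining `m - a` indices, in this order, make up `Fin m`. -/
def splitEquiv {a m : ℕ} (h : a ≤ m) : Fin a ⊕ Fin (m - a) ≃ Fin m :=
  finSumFinEquiv.trans (finCongr (Nat.add_sub_cancel' h))

/-- `BlkD(A, B) ∈ ℝ^{m × n}` for `A ∈ ℝ^{a × b}` and `B ∈ ℝ^{(m-a) × (n-b)}`. -/
def blkD₂ {a b m n : ℕ} (ha : a ≤ m) (hb : b ≤ n) (A : Matrix (Fin a) (Fin b) ℝ)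
    (B : Matrix (Fin (m - a)) (Fin (n - b)) ℝ) : Matrix (Fin m) (Fin n) ℝ :=
  Matrix.reindex (splitEquiv ha) (splitEquiv hb) (Matrix.fromBlocks A 0 0 B)

/-- `BlkD(X_1, …, X_p) ∈ ℝ^{r × r}` for square blocks `X_k` of sizes `h_k` with `∑ h_k = r`. -/
def blkD {p r : ℕ} {h : Fin p → ℕ} (hr : ∑ k, h k = r)
    (X : (k : Fin p) → Matrix (Fin (h k)) (Fin (h k)) ℝ) : Matrix (Fin r) (Fin r) ℝ :=
  Matrix.reindex (finSigmaFinEquiv.trans (finCongr hr)) (finSigmaFinEquiv.trans (finCongr hr))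
    (Matrix.blockDiagonal' X)

/-- `Y = U Σ_Y Vᵀ` is a singular value decomposition of `Y`, where
`Σ_Y = BlkD(diag(y_1, …, y_{d_Y}), 0)` and `y_1 ≥ … ≥ y_{d_Y} ≥ 0`. -/
structure IsSVD {L : ℕ} {d : Fin (L + 1) → ℕ}
    (Y : Matrix (Fin (d (Fin.last L))) (Fin (d 0)) ℝ)
    (U : Matrix (Fin (d (Fin.last L))) (Fin (d (Fin.last L))) ℝ)
    (y : Fin (dY d) → ℝ) (V : Matrix (Fin (d 0)) (Fin (d 0)) ℝ) : Prop where
  left_orthogonal : U ∈ Matrix.orthogonalGroup (Fin (d (Fin.last L))) ℝ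
  right_orthogonal : V ∈ Matrix.orthogonalGroup (Fin (d 0)) ℝ
  antitone : Antitone y
  nonneg : ∀ i, 0 ≤ y i
  eq : Y = U * blkD₂ (dY_le_last d) (dY_le_zero d) (Matrix.diagonal y) 0 * Vᵀ

/-- The indices `0 = s_0 < s_1 < … < s_p = r` split the sorted numbers `y_1 ≥ … ≥ y_n` into the
groups of equal positive values,
`y_{s_0+1} = … = y_{s_1} > y_{s_1+1} = … = y_{s_2} > … > y_{s_{p-1}+1} = … = y_{s_p} > 0`,
followed by `y_{s_p+1} = … = y_n = 0`. (Here `y` is indexed from `0`, so the `k`-th group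
consists of the indices `i` with `s_{k-1} ≤ i < s_k`.) -/
structure IsGrouping {n : ℕ} (y : Fin n → ℝ) (r : ℕ) {p : ℕ} (s : Fin (p + 1) → ℕ) : Prop where
  strictMono : StrictMono s
  first : s 0 = 0
  last : s (Fin.last p) = r
  eq_of_same_group : ∀ (k : Fin p) (i j : Fin n),
    s k.castSucc ≤ i → (i : ℕ) < s k.succ → s k.castSucc ≤ j → (j : ℕ) < s k.succ → y i = y j
  gt_of_later_group : ∀ (k : Fin p) (i j : Fin n),
    (i : ℕ) < s k.succ → s k.succ ≤ j → y j < y i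
  pos : ∀ i : Fin n, (i : ℕ) < r → 0 < y i
  eq_zero : ∀ i : Fin n, r ≤ i → y i = 0

/-- The group sizes (multiplicities) `h_k = s_k - s_{k-1}`. -/
def mult {p : ℕ} (s : Fin (p + 1) → ℕ) (k : Fin p) : ℕ := s k.succ - s k.castSucc

theorem sum_mult_add {p : ℕ} (s : Fin (p + 1) → ℕ) (hs : Monotone s) :
    ∑ k, mult s k + s 0 = s (Fin.last p) := by
  induction p with
  | zero => simp
  | succ p ih =>
    have h1 := ih (fun k => s k.castSucc) (fun a b hab => hs (by simpa using hab))
    rw [Fin.sum_univ_castSucc]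
    have h2 : s (Fin.last p).castSucc ≤ s (Fin.last p).succ :=
      hs (Fin.castSucc_lt_succ).le
    have h3 : ∀ k : Fin p, mult (fun k => s k.castSucc) k = mult s k.castSucc := fun k => rfl
    simp only [h3, Fin.castSucc_zero] at h1
    have h4 : mult s (Fin.last p) = s (Fin.last p).succ - s (Fin.last p).castSucc := rfl
    rw [Fin.succ_last] at h2 h4
    change _ + s 0 = s (Fin.last (p + 1))
    have h5 : s (Fin.last p.succ) = s (Fin.last (p + 1)) := rfl
    omega

theorem IsGrouping.sum_mult {n : ℕ} {y : Fin n → ℝ} {r p : ℕ} {s : Fin (p + 1) → ℕ}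
    (hs : IsGrouping y r s) : ∑ k, mult s k = r := by
  have h := sum_mult_add s hs.strictMono.monotone
  rw [hs.first, hs.last] at h
  simpa using h

theorem rank_le_rows {m n : ℕ} (Y : Matrix (Fin m) (Fin n) ℝ) : Y.rank ≤ m := Y.rank_le_height

theorem rank_le_cols {m n : ℕ} (Y : Matrix (Fin m) (Fin n) ℝ) : Y.rank ≤ n := Y.rank_le_width

/-- The matrix `BlkD(diag(σ) / √c, 0) ∈ ℝ^{d_k × d_j}`; with `c = λ_l`, `k = l`, `j = l - 1` this
is `Σ_l`. -/
noncomputable def sigmaMat {L : ℕ} {d : Fin (L + 1) → ℕ} (c : ℝ) (σ : Fin (dMin d) → ℝ)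
    (k j : Fin (L + 1)) : Matrix (Fin (d k)) (Fin (d j)) ℝ :=
  blkD₂ (dMin_le d k) (dMin_le d j) (Matrix.diagonal fun i => σ i / Real.sqrt c) 0

end DMF

open DMF

open DMF

/-! Write P_k = W_k⋯W_1, S_k = W_L⋯W_{k+1} and M_k = S_kᵀ (Y - P_L) P_kᵀ. The gradient vanishes iff
S_lᵀ (Y - P_L) P_{l-1}ᵀ = λ_l W_l for every l (`isCriticalPoint_iff`). Multiplying by W_lᵀ from the
left or from the right gives M_{l-1} = λ_l W_lᵀ W_l and M_l = λ_l W_l W_lᵀ. Thus consecutive scaled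
weights √λ_l W_l are balanced: an orthonormal eigenbasis of M_0 propagates through the layers, and
all weights become diagonal in common frames Q_k, with the same sequence t up to the factors 1/√λ_l
(`exists_factorization_of_halfGrad_eq_zero`).

In these frames the gradient is an entrywise condition on Y' = Q_Lᵀ Y Q_0. Let a be the number of
positive t_i. The first layer kills the off-diagonal entries of Y' in the rows i < a, the last layer
those in the columns j < a, and the diagonal entries with i < a satisfy the scalar equation. The
remaining block of Y' is arbitrary, but it lives where t vanishes, so its singular value
decomposition can be absorbed into Q_0 and Q_L without changing any W_l. Hence Y is diagonal in the
same frames, with diagonal z ≥ 0 (`isCriticalPoint_iff_exists_factorization`).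

It remains to compare this decomposition of Y with the prescribed one. Singular values are unique up
to order, so z = y ∘ π (`exists_perm_of_svd_eq`). The transition matrices between the two pairs of
frames intertwine Σ_Y, hence commute with Σ_YᵀΣ_Y and Σ_YΣ_Yᵀ; they split into blocks along equal
singular values, and the blocks of the two sides agree where the value is positive
(`IsGrouping.exists_blocks_of_intertwining`). Each step is reversible, which gives the converse. -/

namespace DMF

/-! ### Cancellation rules for orthogonal matrices. -/

section Orthogonal

variable {n : ℕ} (Q : Matrix.orthogonalGroup (Fin n) ℝ)

theorem transpose_mul_self_of_orthogonal : Q.1ᵀ * Q.1 = 1 :=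
  (Matrix.mem_orthogonalGroup_iff' _ _).1 Q.2

theorem mul_transpose_self_of_orthogonal : Q.1 * Q.1ᵀ = 1 :=
  (Matrix.mem_orthogonalGroup_iff _ _).1 Q.2

theorem transpose_mul_cancel_of_orthogonal {m : ℕ} (A : Matrix (Fin n) (Fin m) ℝ) :
    Q.1ᵀ * (Q.1 * A) = A := by
  rw [← Matrix.mul_assoc, transpose_mul_self_of_orthogonal, Matrix.one_mul]

theorem mul_transpose_cancel_of_orthogonal {m : ℕ} (A : Matrix (Fin n) (Fin m) ℝ) :
    Q.1 * (Q.1ᵀ * A) = A := by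
  rw [← Matrix.mul_assoc, mul_transpose_self_of_orthogonal, Matrix.one_mul]

/-- The transpose of an orthogonal matrix as an orthogonal matrix. -/
def orthTranspose : Matrix.orthogonalGroup (Fin n) ℝ :=
  ⟨Q.1ᵀ, (Matrix.mem_orthogonalGroup_iff _ _).2 (by
    rw [transpose_transpose, transpose_mul_self_of_orthogonal])⟩

theorem orthogonal_cancel_iff {m : ℕ} (P : Matrix.orthogonalGroup (Fin m) ℝ)
    (A B : Matrix (Fin m) (Fin n) ℝ) : P.1 * A * Q.1ᵀ = P.1 * B * Q.1ᵀ ↔ A = B := by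
  refine ⟨fun h => ?_, fun h => by rw [h]⟩
  have h' := congrArg (fun X => P.1ᵀ * X * Q.1) h
  simpa [Matrix.mul_assoc, transpose_mul_cancel_of_orthogonal,
    transpose_mul_self_of_orthogonal] using h'

end Orthogonal

/-! ### Rectangular diagonal matrices, with ℕ-indexed diagonals so that one sequence serves all
widths. -/

section RectDiagonal

/-- The `m × n` matrix with the entries `f 0, f 1, …` on the main diagonal. -/
def rdiag (m n : ℕ) (f : ℕ → ℝ) : Matrix (Fin m) (Fin n) ℝ :=
  Matrix.of fun i j => if (i : ℕ) = j then f i else 0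

variable {m n k : ℕ} {f g : ℕ → ℝ}

theorem rdiag_apply (i : Fin m) (j : Fin n) : rdiag m n f i j = if (i : ℕ) = j then f i else 0 :=
  rfl

theorem rdiag_mul_apply (A : Matrix (Fin n) (Fin k) ℝ) (i : Fin m) (j : Fin k) :
    (rdiag m n f * A) i j = if h : (i : ℕ) < n then f i * A ⟨i, h⟩ j else 0 := by
  rw [Matrix.mul_apply]
  split_ifs with h
  · rw [Finset.sum_eq_single ⟨i, h⟩]
    · simp [rdiag_apply]
    · intro b _ hb
      rw [rdiag_apply, if_neg, zero_mul]
      exact fun h' => hb (Fin.ext h'.symm)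
    · simp
  · refine Finset.sum_eq_zero fun b _ => ?_
    rw [rdiag_apply, if_neg, zero_mul]
    omega

theorem transpose_rdiag : (rdiag m n f)ᵀ = rdiag n m f := by
  ext i j
  simp only [transpose_apply, rdiag_apply, eq_comm (a := (j : ℕ))]
  split_ifs with h
  · rw [h]
  · rfl

theorem mul_rdiag_apply (A : Matrix (Fin k) (Fin m) ℝ) (i : Fin k) (j : Fin n) :
    (A * rdiag m n f) i j = if h : (j : ℕ) < m then A i ⟨j, h⟩ * f j else 0 := by
  rw [← transpose_apply (A * _), transpose_mul, transpose_rdiag, rdiag_mul_apply]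
  simp only [transpose_apply, mul_comm]

/-- The inner dimension `n` cuts the diagonal off; the hypothesis ensures that nothing nonzero is
lost there. -/
theorem rdiag_mul_rdiag (h : ∀ i, n ≤ i → f i * g i = 0) :
    rdiag m n f * rdiag n k g = rdiag m k fun i => f i * g i := by
  ext i j
  rw [rdiag_mul_apply, rdiag_apply]
  split_ifs with h1 h2 h2
  · rw [rdiag_apply, if_pos h2]
  · rw [rdiag_apply, if_neg h2, mul_zero]
  · exact (h _ (not_lt.1 h1)).symm
  · rfl

theorem smul_rdiag (c : ℝ) : c • rdiag m n f = rdiag m n fun i => c * f i := by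
  ext i j
  simp only [Matrix.smul_apply, rdiag_apply]
  split_ifs <;> simp

theorem rdiag_eq_diagonal : rdiag n n f = Matrix.diagonal fun i : Fin n => f i := by
  ext i j
  simp only [rdiag_apply, diagonal_apply, Fin.ext_iff]

theorem rdiag_one : rdiag n n (fun _ => 1) = 1 := by
  rw [rdiag_eq_diagonal, diagonal_one]

theorem rdiag_congr (h : ∀ i, i < m → i < n → f i = g i) : rdiag m n f = rdiag m n g := by
  ext i j
  simp only [rdiag_apply]
  split_ifs with h'
  · exact h _ i.2 (h' ▸ j.2)
  · rfl

end RectDiagonal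

/-! ### Two-block diagonal matrices. -/

section Blocks

theorem splitEquiv_inl {a m : ℕ} (h : a ≤ m) (i : Fin a) :
    ((splitEquiv h (Sum.inl i) : Fin m) : ℕ) = i := by
  simp [splitEquiv]

theorem splitEquiv_inr {a m : ℕ} (h : a ≤ m) (i : Fin (m - a)) :
    ((splitEquiv h (Sum.inr i) : Fin m) : ℕ) = a + i := by
  simp [splitEquiv]

/-- A matrix is determined by its entries in the four blocks. -/
theorem ext_splitEquiv {a b m n : ℕ} (ha : a ≤ m) (hb : b ≤ n) {A B : Matrix (Fin m) (Fin n) ℝ}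
    (h : ∀ i j, A (splitEquiv ha i) (splitEquiv hb j) = B (splitEquiv ha i) (splitEquiv hb j)) :
    A = B := by
  ext i j
  simpa using h ((splitEquiv ha).symm i) ((splitEquiv hb).symm j)

theorem blkD₂_apply {a b m n : ℕ} (ha : a ≤ m) (hb : b ≤ n) (A : Matrix (Fin a) (Fin b) ℝ)
    (B : Matrix (Fin (m - a)) (Fin (n - b)) ℝ) (i j) :
    blkD₂ ha hb A B (splitEquiv ha i) (splitEquiv hb j) = Matrix.fromBlocks A 0 0 B i j := by
  simp [blkD₂]

theorem blkD₂_mul {a b c m n k : ℕ} (ha : a ≤ m) (hb : b ≤ n) (hc : c ≤ k)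
    (A : Matrix (Fin a) (Fin b) ℝ) (B : Matrix (Fin (m - a)) (Fin (n - b)) ℝ)
    (A' : Matrix (Fin b) (Fin c) ℝ) (B' : Matrix (Fin (n - b)) (Fin (k - c)) ℝ) :
    blkD₂ ha hb A B * blkD₂ hb hc A' B' = blkD₂ ha hc (A * A') (B * B') := by
  simp only [blkD₂, reindex_apply, submatrix_mul_equiv, fromBlocks_multiply]
  simp

theorem blkD₂_transpose {a b m n : ℕ} (ha : a ≤ m) (hb : b ≤ n) (A : Matrix (Fin a) (Fin b) ℝ)
    (B : Matrix (Fin (m - a)) (Fin (n - b)) ℝ) :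
    (blkD₂ ha hb A B)ᵀ = blkD₂ hb ha Aᵀ Bᵀ := by
  simp [blkD₂, transpose_submatrix, fromBlocks_transpose]

theorem blkD₂_one {a m : ℕ} (ha : a ≤ m) : blkD₂ ha ha 1 1 = 1 := by
  simp [blkD₂]

theorem blkD₂_injective {a b m n : ℕ} (ha : a ≤ m) (hb : b ≤ n) {A A' : Matrix (Fin a) (Fin b) ℝ}
    {B B' : Matrix (Fin (m - a)) (Fin (n - b)) ℝ} (h : blkD₂ ha hb A B = blkD₂ ha hb A' B') :
    A = A' ∧ B = B' := by
  have h' := (Matrix.reindex (splitEquiv ha) (splitEquiv hb)).injective h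
  rw [fromBlocks_inj] at h'
  exact ⟨h'.1, h'.2.2.2⟩

theorem blkD₂_mem_orthogonalGroup_iff {a m : ℕ} (ha : a ≤ m) (A : Matrix (Fin a) (Fin a) ℝ)
    (B : Matrix (Fin (m - a)) (Fin (m - a)) ℝ) :
    blkD₂ ha ha A B ∈ Matrix.orthogonalGroup (Fin m) ℝ ↔
      A ∈ Matrix.orthogonalGroup (Fin a) ℝ ∧ B ∈ Matrix.orthogonalGroup (Fin (m - a)) ℝ := by
  simp only [Matrix.mem_orthogonalGroup_iff, blkD₂_transpose, blkD₂_mul]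
  refine ⟨fun h => blkD₂_injective ha ha (h.trans (blkD₂_one ha).symm), fun h => ?_⟩
  rw [h.1, h.2, blkD₂_one]

theorem blkD₂_rdiag {a m n : ℕ} (h : a ≤ m) (h' : a ≤ n) (f : Fin a → ℝ) (g : ℕ → ℝ) :
    blkD₂ h h' (Matrix.diagonal f) (rdiag (m - a) (n - a) g) =
      rdiag m n fun i => if hi : i < a then f ⟨i, hi⟩ else g (i - a) := by
  refine ext_splitEquiv h h' fun i j => ?_
  rw [blkD₂_apply, rdiag_apply]
  rcases i with i | i <;> rcases j with j | j <;>
    simp [splitEquiv_inl, splitEquiv_inr, diagonal_apply, Fin.ext_iff, rdiag_apply]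
  · intro h; have := i.2; omega
  · intro h; have := j.2; omega

theorem blkD₂_zero_eq_rdiag {a m n : ℕ} (h : a ≤ m) (h' : a ≤ n) (f : Fin a → ℝ) :
    blkD₂ h h' (Matrix.diagonal f) 0 = rdiag m n fun i => if hi : i < a then f ⟨i, hi⟩ else 0 := by
  have : (0 : Matrix (Fin (m - a)) (Fin (n - a)) ℝ) = rdiag _ _ fun _ => 0 := by
    ext; simp [rdiag_apply]
  rw [this]
  exact blkD₂_rdiag h h' f fun _ => 0

/-- `R` acts only on coordinates where the diagonal vanishes. This is the freedom that allows the
frames to be changed while the weights stay fixed. -/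
theorem rdiag_mul_blkD₂ {a m n : ℕ} (h : a ≤ n) (f : ℕ → ℝ) (hf : ∀ i, a ≤ i → f i = 0)
    (R : Matrix (Fin (n - a)) (Fin (n - a)) ℝ) :
    rdiag m n f * blkD₂ h h 1 R = rdiag m n f := by
  ext i j
  rw [rdiag_mul_apply]
  obtain ⟨j, rfl⟩ := (splitEquiv h).surjective j
  split_ifs with hi
  · by_cases hia : (i : ℕ) < a
    · have : (⟨i, hi⟩ : Fin n) = splitEquiv h (Sum.inl ⟨i, hia⟩) := by
        ext; simp [splitEquiv_inl]
      rw [this, blkD₂_apply, rdiag_apply]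
      rcases j with j | j
      · simp [splitEquiv_inl, one_apply, Fin.ext_iff]
      · simp [splitEquiv_inr]
        intro h; omega
    · simp [rdiag_apply, hf _ (not_lt.1 hia)]
  · rw [rdiag_apply, if_neg]
    have := (splitEquiv h j).2
    omega

end Blocks

/-! ### Singular value decompositions from Gram matrices. -/

section SingularValues

open WithLp in
/-- The columns of `M` are orthogonal, so that `M` is an orthogonal matrix times a
diagonal one. -/
theorem exists_orthogonal_mul_rdiag {m n : ℕ} (M : Matrix (Fin m) (Fin n) ℝ) {t : ℕ → ℝ}
    (ht : Antitone t) (ht0 : ∀ i, 0 ≤ t i) (htn : ∀ i, n ≤ i → t i = 0)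
    (hM : Mᵀ * M = rdiag n n fun i => t i ^ 2) :
    (∃ P : Matrix.orthogonalGroup (Fin m) ℝ, M = P.1 * rdiag m n t) ∧ ∀ i, m ≤ i → t i = 0 := by
  have hdot : ∀ i j : Fin n, ∑ k, M k i * M k j = if i = j then t i ^ 2 else 0 := by
    intro i j
    have := congrFun (congrFun hM i) j
    simpa [Matrix.mul_apply, rdiag_apply, Fin.ext_iff] using this
  have hv : Orthonormal ℝ (fun j : {j : Fin n // 0 < t j} =>
      (toLp 2 fun k => M k j / t j : EuclideanSpace ℝ (Fin m))) := by
    rw [orthonormal_iff_ite]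
    rintro ⟨i, hi⟩ ⟨j, hj⟩
    have : inner ℝ (toLp 2 fun k => M k i / t i : EuclideanSpace ℝ (Fin m))
        (toLp 2 fun k => M k j / t j) = (∑ k, M k i * M k j) / (t i * t j) := by
      rw [PiLp.inner_apply, Finset.sum_div]
      refine Finset.sum_congr rfl fun k _ => ?_
      simp
      field_simp
    rw [this, hdot]
    by_cases hij : i = j
    · subst hij
      simp
      field_simp
    · simp [hij]
  -- Otherwise monotonicity makes t_0, …, t_m all positive, and the normalised columns would be `m +
  -- 1` orthonormal vectors in ℝ^m.
  have hm : ∀ i, m ≤ i → t i = 0 := by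
    intro i hi
    by_contra hne
    have hpos : ∀ j : Fin (m + 1), 0 < t j := fun j =>
      ((ht0 i).lt_of_ne' hne).trans_le (ht (by have := j.2; omega))
    have hlt : ∀ j : Fin (m + 1), (j : ℕ) < n := fun j => by
      by_contra hj
      exact (hpos j).ne' (htn _ (not_lt.1 hj))
    have hinj : Function.Injective
        (fun j : Fin (m + 1) => (⟨⟨j, hlt j⟩, hpos j⟩ : {j : Fin n // 0 < t j})) := by
      intro a b hab
      simpa [Fin.ext_iff] using hab
    have := (hv.comp _ hinj).linearIndependent.fintype_card_le_finrank
    simp at this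
  refine ⟨?_, hm⟩
  -- Indexing by `Fin m` keeps each normalised column at its own position in the extended basis. The
  -- default 0 is harmless: only indices in `s` are prescribed, and these lie below `n`.
  let v : Fin m → EuclideanSpace ℝ (Fin m) := fun j =>
    if h : (j : ℕ) < n then toLp 2 fun k => M k ⟨j, h⟩ / t j else 0
  let s : Set (Fin m) := {j | 0 < t j}
  have hs : Orthonormal ℝ (s.domRestrict v) := by
    have hlt : ∀ j : s, (j.1 : ℕ) < n := fun j => by
      by_contra hj
      exact (show 0 < t j.1 from j.2).ne' (htn _ (not_lt.1 hj))
    let e : s → {j : Fin n // 0 < t j} := fun j => ⟨⟨j.1, hlt j⟩, j.2⟩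
    have he : Function.Injective e := by
      intro a b hab
      simpa [e, Fin.ext_iff, Subtype.ext_iff] using hab
    convert hv.comp e he using 1
    ext1 j
    simp [v, e, hlt j]
  obtain ⟨b, hb⟩ := hs.exists_orthonormalBasis_extension_of_card_eq (by simp)
  let P : Matrix (Fin m) (Fin m) ℝ := Matrix.of fun i j => b j i
  have hP : P ∈ Matrix.orthogonalGroup (Fin m) ℝ := by
    rw [Matrix.mem_orthogonalGroup_iff']
    ext i j
    have := (orthonormal_iff_ite.1 b.orthonormal) i j
    rw [PiLp.inner_apply] at this
    simpa [P, Matrix.mul_apply, Matrix.one_apply, mul_comm] using this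
  refine ⟨⟨P, hP⟩, ?_⟩
  ext i j
  rw [mul_rdiag_apply]
  -- The squared norm of column `j` is `t j ^ 2`.
  have hzero : t j = 0 → M i j = 0 := by
    intro h0
    have h := hdot j j
    rw [if_pos rfl, h0, zero_pow two_ne_zero,
      Finset.sum_eq_zero_iff_of_nonneg fun k _ => mul_self_nonneg _] at h
    exact mul_self_eq_zero.1 (h i (Finset.mem_univ _))
  split_ifs with h
  · rcases (ht0 j).eq_or_lt with h0 | h0
    · rw [hzero h0.symm, ← h0, mul_zero]
    · have := hb ⟨j, h⟩ h0
      simp [P, this, v, h0.ne']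
  · exact hzero (hm _ (not_lt.1 h))

/-- The right frame is prescribed rather than chosen, so the decomposition of one layer can continue
that of the previous layer. -/
theorem exists_orthogonal_mul_rdiag_mul_transpose {m n : ℕ} (Z : Matrix (Fin m) (Fin n) ℝ)
    (Q : Matrix.orthogonalGroup (Fin n) ℝ) {t : ℕ → ℝ}
    (ht : Antitone t) (ht0 : ∀ i, 0 ≤ t i) (htn : ∀ i, n ≤ i → t i = 0)
    (hZ : Zᵀ * Z = Q.1 * rdiag n n (fun i => t i ^ 2) * Q.1ᵀ) :
    (∃ P : Matrix.orthogonalGroup (Fin m) ℝ, Z = P.1 * rdiag m n t * Q.1ᵀ) ∧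
      ∀ i, m ≤ i → t i = 0 := by
  obtain ⟨⟨P, hP⟩, h⟩ := exists_orthogonal_mul_rdiag (Z * Q.1) ht ht0 htn (by
    rw [transpose_mul, Matrix.mul_assoc, ← Matrix.mul_assoc Zᵀ, hZ]
    simp only [Matrix.mul_assoc, transpose_mul_cancel_of_orthogonal,
      transpose_mul_self_of_orthogonal, Matrix.mul_one])
  refine ⟨⟨P, ?_⟩, h⟩
  rw [← hP, Matrix.mul_assoc, mul_transpose_self_of_orthogonal, Matrix.mul_one]

/-- A Gram matrix is orthogonally similar to a diagonal matrix with decreasing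
nonnegative entries. -/
theorem exists_gram_eq {m n : ℕ} (Z : Matrix (Fin m) (Fin n) ℝ) :
    ∃ (Q : Matrix.orthogonalGroup (Fin n) ℝ) (t : ℕ → ℝ), Antitone t ∧ (∀ i, 0 ≤ t i) ∧
      (∀ i, n ≤ i → t i = 0) ∧ Zᵀ * Z = Q.1 * rdiag n n (fun i => t i ^ 2) * Q.1ᵀ := by
  have hpsd : (Zᵀ * Z).PosSemidef := by
    simpa using Matrix.posSemidef_conjTranspose_mul_self Z
  set hA := hpsd.isHermitian
  -- Sorting the negatives lists the eigenvalues in decreasing order.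
  let τ : Equiv.Perm (Fin n) := Tuple.sort fun i => -hA.eigenvalues i
  have hτ : Antitone (hA.eigenvalues ∘ τ) := by
    intro a b hab
    have := Tuple.monotone_sort (fun i => -hA.eigenvalues i) hab
    simpa [τ] using this
  let t : ℕ → ℝ := fun i => if h : i < n then √(hA.eigenvalues (τ ⟨i, h⟩)) else 0
  let Q : Matrix (Fin n) (Fin n) ℝ := hA.eigenvectorUnitary.1.submatrix id τ
  have hU : hA.eigenvectorUnitary.1ᵀ * hA.eigenvectorUnitary.1 = 1 := by
    simpa [Matrix.star_eq_conjTranspose] using Unitary.coe_star_mul_self hA.eigenvectorUnitary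
  have hQ : Q ∈ Matrix.orthogonalGroup (Fin n) ℝ := by
    rw [Matrix.mem_orthogonalGroup_iff']
    simp only [Q, transpose_submatrix]
    rw [← submatrix_mul _ _ τ id τ Function.bijective_id, hU]
    simp
  refine ⟨⟨Q, hQ⟩, t, ?_, ?_, ?_, ?_⟩
  · intro a b hab
    simp only [t]
    split_ifs with hb ha
    · exact Real.sqrt_le_sqrt (hτ (show (⟨a, ha⟩ : Fin n) ≤ ⟨b, hb⟩ from hab))
    · omega
    · positivity
    · rfl
  · intro i
    simp only [t]
    split_ifs <;> positivity
  · intro i hi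
    simp [t, not_lt.2 hi]
  · conv_lhs => rw [hA.spectral_theorem]
    have hd : rdiag n n (fun i => t i ^ 2) =
        (Matrix.diagonal hA.eigenvalues).submatrix τ τ := by
      ext i j
      simp [rdiag_apply, t, diagonal_apply, Fin.ext_iff, Real.sq_sqrt (hpsd.eigenvalues_nonneg _)]
    rw [hd]
    simp only [Q, transpose_submatrix]
    rw [submatrix_mul_equiv, submatrix_mul_equiv]
    simp [Unitary.conjStarAlgAut_apply, Matrix.star_eq_conjTranspose]

/-- Existence of a singular value decomposition. -/
theorem exists_svd {m n : ℕ} (Z : Matrix (Fin m) (Fin n) ℝ) :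
    ∃ (P : Matrix.orthogonalGroup (Fin m) ℝ) (Q : Matrix.orthogonalGroup (Fin n) ℝ) (t : ℕ → ℝ),
      (∀ i, 0 ≤ t i) ∧ Z = P.1 * rdiag m n t * Q.1ᵀ := by
  obtain ⟨Q, t, h1, h2, h3, h4⟩ := exists_gram_eq Z
  obtain ⟨⟨P, hP⟩, _⟩ := exists_orthogonal_mul_rdiag_mul_transpose Z Q h1 h2 h3 h4
  exact ⟨P, Q, t, h2, hP⟩

end SingularValues

/-! ### Partial products from both ends of the network. -/

section Products

variable {L : ℕ} {d : Fin (L + 1) → ℕ}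

/-- The partial product `W_L ⋯ W_{k+1}` (the identity for `k = L`). -/
def suffixProd (W : Weights d) (k : Fin (L + 1)) :
    Matrix (Fin (d (Fin.last L))) (Fin (d k)) ℝ :=
  Fin.reverseInduction (motive := fun k => Matrix (Fin (d (Fin.last L))) (Fin (d k)) ℝ)
    (1 : Matrix (Fin (d (Fin.last L))) (Fin (d (Fin.last L))) ℝ) (fun l S => S * W l) k

theorem partialProd_succ (W : Weights d) (l : Fin L) :
    partialProd W l.succ = W l * partialProd W l.castSucc := by
  simp only [partialProd, Fin.induction_succ]

theorem suffixProd_last (W : Weights d) : suffixProd W (Fin.last L) = 1 := by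
  simp only [suffixProd, Fin.reverseInduction_last]

theorem suffixProd_castSucc (W : Weights d) (l : Fin L) :
    suffixProd W l.castSucc = suffixProd W l.succ * W l := by
  simp only [suffixProd, Fin.reverseInduction_castSucc]

theorem suffixProd_mul_partialProd (W : Weights d) (k : Fin (L + 1)) :
    suffixProd W k * partialProd W k = partialProd W (Fin.last L) := by
  induction k using Fin.reverseInduction with
  | last => rw [suffixProd_last, Matrix.one_mul]
  | cast l ih => rw [← ih, suffixProd_castSucc, partialProd_succ, Matrix.mul_assoc]

theorem partialProd_update (W : Weights d) (l : Fin L) (H) (k : Fin (L + 1))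
    (hk : k ≤ l.castSucc) : partialProd (Function.update W l H) k = partialProd W k := by
  induction k using Fin.induction with
  | zero => rfl
  | succ i ih =>
    have hi : i < l := by
      simp only [Fin.le_def, Fin.lt_def, Fin.val_succ, Fin.val_castSucc] at hk ⊢; omega
    rw [partialProd_succ, partialProd_succ, ih (by simpa using hi.le),
      Function.update_of_ne hi.ne]

theorem suffixProd_update (W : Weights d) (l : Fin L) (H) (k : Fin (L + 1))
    (hk : l.succ ≤ k) : suffixProd (Function.update W l H) k = suffixProd W k := by
  induction k using Fin.reverseInduction with
  | last => rw [suffixProd_last, suffixProd_last]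
  | cast i ih =>
    have hi : l < i := by
      simp only [Fin.le_def, Fin.lt_def, Fin.val_succ, Fin.val_castSucc] at hk ⊢; omega
    rw [suffixProd_castSucc, suffixProd_castSucc, ih (by simpa using hi.le),
      Function.update_of_ne hi.ne']

/-- The full product is linear in each single layer; the factors on the two sides do not involve
that layer. -/
theorem partialProd_update_last (W : Weights d) (l : Fin L) (H) :
    partialProd (Function.update W l H) (Fin.last L) =
      suffixProd W l.succ * H * partialProd W l.castSucc := by
  rw [← suffixProd_mul_partialProd _ l.succ, partialProd_succ, Function.update_self,
    suffixProd_update _ _ _ _ le_rfl, partialProd_update _ _ _ _ le_rfl, Matrix.mul_assoc]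

end Products

/-! ### The gradient of the loss, layer by layer. -/

section Derivative

theorem frobenius_norm_sq {m n : ℕ} (A : Matrix (Fin m) (Fin n) ℝ) :
    ‖A‖ ^ 2 = ∑ i, ∑ j, A i j ^ 2 := by
  rw [Matrix.frobenius_norm_def, ← Real.sqrt_eq_rpow, Real.sq_sqrt (by positivity)]
  simp

variable {L : ℕ} {d : Fin (L + 1) → ℕ}

theorem differentiable_entry (l : Fin L) (i j) : Differentiable ℝ fun W : Weights d => W l i j :=
  (LinearMap.toContinuousLinearMap
    ({ toFun := fun W => W l i j, map_add' := fun _ _ => rfl, map_smul' := fun _ _ => rfl } :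
      Weights d →ₗ[ℝ] ℝ)).differentiable

theorem differentiable_partialProd (k : Fin (L + 1)) :
    ∀ i j, Differentiable ℝ fun W : Weights d => partialProd W k i j := by
  induction k using Fin.induction with
  | zero => exact fun i j => differentiable_const _
  | succ l ih =>
    intro i j
    simp only [partialProd_succ, Matrix.mul_apply]
    exact Differentiable.fun_sum fun k _ => (differentiable_entry l i k).mul (ih k j)

theorem differentiable_loss (lam : Fin L → ℝ)
    (Y : Matrix (Fin (d (Fin.last L))) (Fin (d 0)) ℝ) : Differentiable ℝ (loss lam Y) := by
  unfold loss
  simp only [frobenius_norm_sq]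
  refine Differentiable.fun_add
    (Differentiable.fun_sum fun i _ => Differentiable.fun_sum fun j _ => ?_)
    (Differentiable.fun_sum fun l _ => Differentiable.const_mul
      (Differentiable.fun_sum fun i _ => Differentiable.fun_sum fun j _ => ?_) _)
  · exact ((differentiable_partialProd _ i j).sub_const _).pow 2
  · exact (differentiable_entry l i j).pow 2

/-- Half of the partial gradient of the loss with respect to `W_l`. -/
def halfGrad (lam : Fin L → ℝ) (Y : Matrix (Fin (d (Fin.last L))) (Fin (d 0)) ℝ)
    (W : Weights d) (l : Fin L) : Matrix (Fin (d l.succ)) (Fin (d l.castSucc)) ℝ :=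
  (suffixProd W l.succ)ᵀ * (partialProd W (Fin.last L) - Y) * (partialProd W l.castSucc)ᵀ
    + lam l • W l

theorem hasDerivAt_frobenius_sq {m n : ℕ} (A B : Matrix (Fin m) (Fin n) ℝ) :
    HasDerivAt (fun x : ℝ => ‖A + x • B‖ ^ 2) (2 * (Aᵀ * B).trace) 0 := by
  simp only [frobenius_norm_sq, Matrix.add_apply, Matrix.smul_apply, smul_eq_mul]
  have h : 2 * (Aᵀ * B).trace = ∑ i, ∑ j, 2 * (A i j * B i j) := by
    rw [Matrix.trace, Finset.mul_sum, Finset.sum_comm]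
    refine Finset.sum_congr rfl fun j _ => ?_
    rw [diag_apply, Matrix.mul_apply, Finset.mul_sum]
    rfl
  rw [h]
  refine HasDerivAt.fun_sum fun i _ => HasDerivAt.fun_sum fun j _ => ?_
  have := (((hasDerivAt_id (0 : ℝ)).mul_const (B i j)).const_add (A i j)).pow 2
  refine this.congr_deriv ?_
  simp
  ring

/-- Along a line in one layer both terms are squared norms of affine functions. Cyclicity of the
trace moves the outer factors away from `H` and exposes the gradient for the Frobenius inner
product. -/
theorem hasDerivAt_loss_update (lam : Fin L → ℝ)
    (Y : Matrix (Fin (d (Fin.last L))) (Fin (d 0)) ℝ) (W : Weights d) (l : Fin L)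
    (H : Matrix (Fin (d l.succ)) (Fin (d l.castSucc)) ℝ) :
    HasDerivAt (fun x : ℝ => loss lam Y (Function.update W l (W l + x • H)))
      (2 * ((halfGrad lam Y W l)ᵀ * H).trace) 0 := by
  have hprod : partialProd W (Fin.last L) =
      suffixProd W l.succ * W l * partialProd W l.castSucc := by
    rw [← suffixProd_mul_partialProd W l.succ, partialProd_succ, Matrix.mul_assoc]
  have h1 := hasDerivAt_frobenius_sq (partialProd W (Fin.last L) - Y)
    (suffixProd W l.succ * H * partialProd W l.castSucc)
  have h2 : HasDerivAt
      (fun x : ℝ => ∑ k, lam k * ‖Function.update W l (W l + x • H) k‖ ^ 2)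
      (∑ k, if k = l then lam l * (2 * ((W l)ᵀ * H).trace) else 0) 0 := by
    refine HasDerivAt.fun_sum fun k _ => ?_
    split_ifs with hk
    · subst hk
      simp only [Function.update_self]
      exact (hasDerivAt_frobenius_sq (W k) H).const_mul _
    · simp only [Function.update_of_ne hk]
      exact hasDerivAt_const _ _
  have hfun : (fun x : ℝ => loss lam Y (Function.update W l (W l + x • H))) = fun x : ℝ =>
      ‖partialProd W (Fin.last L) - Y
        + x • (suffixProd W l.succ * H * partialProd W l.castSucc)‖ ^ 2
      + ∑ k, lam k * ‖Function.update W l (W l + x • H) k‖ ^ 2 := by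
    ext x
    rw [loss, partialProd_update_last, hprod, Matrix.mul_add, Matrix.add_mul, Matrix.mul_smul,
      Matrix.smul_mul, add_sub_right_comm]
  rw [hfun]
  refine (h1.fun_add h2).congr_deriv ?_
  · rw [Finset.sum_ite_eq' Finset.univ l, if_pos (Finset.mem_univ _), halfGrad, transpose_add,
      Matrix.add_mul, trace_add, transpose_smul, Matrix.smul_mul, trace_smul, smul_eq_mul, mul_add,
      transpose_mul, transpose_mul, transpose_transpose, transpose_transpose, Matrix.mul_assoc
        (partialProd W l.castSucc), trace_mul_comm (partialProd W l.castSucc)]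
    simp only [Matrix.mul_assoc]
    ring

theorem eq_zero_of_trace_transpose_mul {m n : ℕ} {A : Matrix (Fin m) (Fin n) ℝ}
    (h : (Aᵀ * A).trace = 0) : A = 0 := by
  have h' : ∑ j, ∑ i, A i j * A i j = 0 := by
    simpa [Matrix.trace, Matrix.mul_apply] using h
  ext i j
  rw [Finset.sum_eq_zero_iff_of_nonneg
    fun _ _ => Finset.sum_nonneg fun _ _ => mul_self_nonneg _] at h'
  have := h' j (Finset.mem_univ _)
  rw [Finset.sum_eq_zero_iff_of_nonneg fun _ _ => mul_self_nonneg _] at this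
  exact mul_self_eq_zero.1 (this i (Finset.mem_univ _))

/-- Single-layer directions span the space, so the partial derivatives determine the differential.
Testing layer `l` in the direction of its own gradient yields a squared norm. -/
theorem isCriticalPoint_iff (lam : Fin L → ℝ)
    (Y : Matrix (Fin (d (Fin.last L))) (Fin (d 0)) ℝ) (W : Weights d) :
    IsCriticalPoint lam Y W ↔ ∀ l, halfGrad lam Y W l = 0 := by
  have hF := (differentiable_loss lam Y W).hasFDerivAt
  have key : ∀ l H, fderiv ℝ (loss lam Y) W (Pi.single l H) =
      2 * ((halfGrad lam Y W l)ᵀ * H).trace := by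
    intro l H
    have hline : ∀ x : ℝ, Function.update W l (W l + x • H) =
        W + x • (Pi.single l H : Weights d) := by
      intro x
      ext k : 1
      by_cases hk : k = l
      · subst hk; simp
      · simp [hk]
    have h1 := hasDerivAt_loss_update lam Y W l H
    simp only [hline] at h1
    have h2 : HasDerivAt (fun x : ℝ => W + x • (Pi.single l H : Weights d)) (Pi.single l H) 0 := by
      have := ((hasDerivAt_id (0 : ℝ)).smul_const (Pi.single l H : Weights d)).const_add W
      rw [one_smul] at this
      exact this
    have h3 : HasFDerivAt (loss lam Y) (fderiv ℝ (loss lam Y) W)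
        (W + (0 : ℝ) • (Pi.single l H : Weights d)) := by
      simpa using hF
    have h4 := h3.comp_hasDerivAt (0 : ℝ) h2
    exact h4.unique h1
  constructor
  · intro h l
    have h0 : fderiv ℝ (loss lam Y) W = 0 := HasFDerivAt.fderiv h
    have := key l (halfGrad lam Y W l)
    rw [h0] at this
    refine eq_zero_of_trace_transpose_mul ?_
    have h' : (0 : ℝ) = 2 * ((halfGrad lam Y W l)ᵀ * halfGrad lam Y W l).trace := this
    linarith
  · intro h
    have h0 : fderiv ℝ (loss lam Y) W = 0 := by
      ext V
      rw [← Finset.univ_sum_single V, map_sum]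
      refine Finset.sum_eq_zero fun l _ => ?_
      rw [key, h]
      simp
    rw [h0] at hF
    exact hF

end Derivative

/-! ### The scalar critical point equation. -/

section Scalar

variable {L : ℕ}

/-- The product of the first `k` of the numbers `x`. -/
def prefixScalar (x : Fin L → ℝ) (k : Fin (L + 1)) : ℝ :=
  ∏ j with j.castSucc < k, x j

/-- The product of all but the first `k` of the numbers `x`. -/
def suffixScalar (x : Fin L → ℝ) (k : Fin (L + 1)) : ℝ :=
  ∏ j with k ≤ j.castSucc, x j

theorem prefixScalar_zero (x : Fin L → ℝ) : prefixScalar x 0 = 1 := by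
  simp [prefixScalar]

theorem prefixScalar_last (x : Fin L → ℝ) : prefixScalar x (Fin.last L) = ∏ j, x j := by
  simp [prefixScalar, Fin.castSucc_lt_last]

theorem suffixScalar_last (x : Fin L → ℝ) : suffixScalar x (Fin.last L) = 1 := by
  simp [suffixScalar, Fin.castSucc_ne_last]

theorem prefixScalar_succ (x : Fin L → ℝ) (l : Fin L) :
    prefixScalar x l.succ = x l * prefixScalar x l.castSucc := by
  have : Finset.univ.filter (fun j : Fin L => j.castSucc < l.succ) =
      insert l (Finset.univ.filter fun j : Fin L => j.castSucc < l.castSucc) := by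
    ext j
    simp only [Finset.mem_filter, Finset.mem_univ, true_and, Finset.mem_insert, Fin.lt_def,
      Fin.ext_iff, Fin.val_succ, Fin.val_castSucc]
    omega
  rw [prefixScalar, this, Finset.prod_insert (by simp), prefixScalar]

theorem suffixScalar_castSucc (x : Fin L → ℝ) (l : Fin L) :
    suffixScalar x l.castSucc = suffixScalar x l.succ * x l := by
  have : Finset.univ.filter (fun j : Fin L => l.castSucc ≤ j.castSucc) =
      insert l (Finset.univ.filter fun j : Fin L => l.succ ≤ j.castSucc) := by
    ext j
    simp only [Finset.mem_filter, Finset.mem_univ, true_and, Finset.mem_insert, Fin.le_def,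
      Fin.ext_iff, Fin.val_succ, Fin.val_castSucc]
    omega
  rw [suffixScalar, this, Finset.prod_insert (by simp [Fin.le_def]), suffixScalar, mul_comm]

theorem suffixScalar_mul_prefixScalar (x : Fin L → ℝ) (l : Fin L) :
    suffixScalar x l.succ * prefixScalar x l.castSucc = ∏ j ∈ Finset.univ.erase l, x j := by
  rw [suffixScalar, prefixScalar, ← Finset.prod_union]
  · congr 1
    ext j
    simp only [Finset.mem_filter, Finset.mem_univ, true_and, Finset.mem_union, Finset.mem_erase,
      and_true, Fin.lt_def, Fin.le_def, ne_eq, Fin.ext_iff, Fin.val_succ, Fin.val_castSucc]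
    omega
  · rw [Finset.disjoint_filter]
    intro j _ h
    simp only [Fin.lt_def, Fin.le_def, Fin.val_succ, Fin.val_castSucc] at h ⊢
    omega

theorem prod_div_sqrt {lam : Fin L → ℝ} (hlam : ∀ l, 0 < lam l) (t : ℝ) :
    ∏ l, t / √(lam l) = t ^ L / √(∏ l, lam l) := by
  rw [Finset.prod_div_distrib, Real.sqrt_prod _ fun l _ => (hlam l).le]
  simp

/-- The critical point equation of layer `l` for scalar weights `t / √λ_l` and positive `t`. -/
theorem scalar_equation_iff_of_pos {N : ℕ} {lam : Fin (N + 2) → ℝ} (hlam : ∀ l, 0 < lam l)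
    {t : ℝ} (ht : 0 < t) (z : ℝ) (l : Fin (N + 2)) :
    (∏ j ∈ Finset.univ.erase l, t / √(lam j)) * (∏ j, t / √(lam j) - z)
        + lam l * (t / √(lam l)) = 0 ↔
      t ^ (2 * (N + 2) - 1) - √(∏ l, lam l) * z * t ^ ((N + 2) - 1) + (∏ l, lam l) * t = 0 := by
  have hΛ : 0 < ∏ l, lam l := Finset.prod_pos fun l _ => hlam l
  have hs : 0 < √(∏ l, lam l) := Real.sqrt_pos.2 hΛ
  have hΛs : √(∏ l, lam l) * √(∏ l, lam l) = ∏ l, lam l := Real.mul_self_sqrt hΛ.le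
  have hx : 0 < t / √(lam l) := div_pos ht (Real.sqrt_pos.2 (hlam l))
  have hprod : (∏ j ∈ Finset.univ.erase l, t / √(lam j)) * (t / √(lam l)) = 
      t ^ (N + 2) / √(∏ l, lam l) := by
    rw [← prod_div_sqrt hlam, Finset.prod_erase_mul _ _ (Finset.mem_univ l)]
  rw [prod_div_sqrt hlam]
  have hsq : lam l * (t / √(lam l)) * (t / √(lam l)) = t ^ 2 := by
    rw [mul_assoc, div_mul_div_comm, Real.mul_self_sqrt (hlam l).le, mul_div_cancel₀ _ (hlam l).ne']
    ring
  generalize ∏ l, lam l = Λ at *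
  generalize √Λ = s at *
  subst hΛs
  generalize t / √(lam l) = x at *
  generalize (∏ j ∈ Finset.univ.erase l, t / √(lam j)) = c at *
  have e1 : 2 * (N + 2) - 1 = 2 * N + 3 := by omega
  have e2 : N + 2 - 1 = N + 1 := by omega
  rw [e1, e2]
  -- The factor `x` completes the punctured product `c` to t^L / √λ and turns λ_l x into t²; the
  -- factor λ = s² clears denominators. No dependence on the layer remains.
  have key : (c * (t ^ (N + 2) / s - z) + lam l * x) * (x * (s * s)) =
      t * (t ^ (2 * N + 3) - s * z * t ^ (N + 1) + s * s * t) := by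
    calc _ = (c * x) * (t ^ (N + 2) / s - z) * (s * s) + (lam l * x * x) * (s * s) := by ring
      _ = _ := by
        rw [hprod, hsq]
        field_simp
        ring
  constructor
  · intro h
    rw [h, zero_mul, eq_comm, mul_eq_zero] at key
    exact key.resolve_left ht.ne'
  · intro h
    rw [h, mul_zero, mul_eq_zero] at key
    exact key.resolve_right (mul_pos hx hΛ).ne'

/-- For t = 0 the punctured product vanishes, because at least one other layer is left. -/
theorem scalar_equation {N : ℕ} {lam : Fin (N + 2) → ℝ} (hlam : ∀ l, 0 < lam l)
    {t : ℝ} (ht : 0 ≤ t) {z : ℝ}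
    (h : t ^ (2 * (N + 2) - 1) - √(∏ l, lam l) * z * t ^ ((N + 2) - 1) + (∏ l, lam l) * t = 0)
    (l : Fin (N + 2)) :
    (∏ j ∈ Finset.univ.erase l, t / √(lam j)) * (∏ j, t / √(lam j) - z)
        + lam l * (t / √(lam l)) = 0 := by
  rcases ht.eq_or_lt with rfl | ht
  · simp
  · exact (scalar_equation_iff_of_pos hlam ht z l).2 h

end Scalar

/-! ### The gradient when all weights are diagonal in common frames. -/

section Factored

variable {L : ℕ} {d : Fin (L + 1) → ℕ} {W : Weights d}
  {Q : (k : Fin (L + 1)) → Matrix.orthogonalGroup (Fin (d k)) ℝ} {f : Fin L → ℕ → ℝ}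

/-- Adjacent frames cancel. By `hf` the diagonals vanish beyond every width, so a narrow layer
truncates nothing. -/
theorem partialProd_eq_of_factored (hf : ∀ l k i, d k ≤ i → f l i = 0)
    (hW : ∀ l, W l = (Q l.succ).1 * rdiag (d l.succ) (d l.castSucc) (f l) * (Q l.castSucc).1ᵀ) (k : Fin (L + 1)) :
    partialProd W k =
      (Q k).1 * rdiag (d k) (d 0) (fun i => prefixScalar (f · i) k) * (Q 0).1ᵀ := by
  induction k using Fin.induction with
  | zero =>
    simp only [prefixScalar_zero, rdiag_one, Matrix.mul_one, mul_transpose_self_of_orthogonal]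
    rfl
  | succ l ih =>
    rw [partialProd_succ, ih, hW]
    simp only [Matrix.mul_assoc, transpose_mul_cancel_of_orthogonal]
    rw [← Matrix.mul_assoc (rdiag _ _ _),
      rdiag_mul_rdiag fun i hi => by rw [hf l _ i hi, zero_mul]]
    simp only [prefixScalar_succ]

theorem suffixProd_eq_of_factored (hf : ∀ l k i, d k ≤ i → f l i = 0)
    (hW : ∀ l, W l = (Q l.succ).1 * rdiag (d l.succ) (d l.castSucc) (f l) * (Q l.castSucc).1ᵀ) (k : Fin (L + 1)) :
    suffixProd W k = (Q (Fin.last L)).1 *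
      rdiag (d (Fin.last L)) (d k) (fun i => suffixScalar (f · i) k) * (Q k).1ᵀ := by
  induction k using Fin.reverseInduction with
  | last =>
    simp only [suffixScalar_last, rdiag_one, Matrix.mul_one, mul_transpose_self_of_orthogonal,
      suffixProd_last]
  | cast l ih =>
    rw [suffixProd_castSucc, ih, hW]
    simp only [Matrix.mul_assoc, transpose_mul_cancel_of_orthogonal]
    rw [← Matrix.mul_assoc (rdiag _ _ _),
      rdiag_mul_rdiag fun i hi => by rw [hf l _ i hi, mul_zero]]
    simp only [suffixScalar_castSucc]

/-- The outer frames cancel, leaving one equation per entry. Entries outside the range of `Y'` carry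
no data term, and there the regularisation term vanishes by `hf`. -/
theorem halfGrad_eq_zero_iff_of_factored (hf : ∀ l k i, d k ≤ i → f l i = 0)
    (hW : ∀ l, W l = (Q l.succ).1 * rdiag (d l.succ) (d l.castSucc) (f l) * (Q l.castSucc).1ᵀ) (lam : Fin L → ℝ)
    {Y Y' : Matrix (Fin (d (Fin.last L))) (Fin (d 0)) ℝ}
    (hY : Y = (Q (Fin.last L)).1 * Y' * (Q 0).1ᵀ) (l : Fin L) :
    halfGrad lam Y W l = 0 ↔
      ∀ (i j : ℕ) (_ : i < d l.succ) (_ : j < d l.castSucc) (hi : i < d (Fin.last L))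
        (hj : j < d 0),
        suffixScalar (f · i) l.succ * ((if i = j then ∏ k, f k i else 0) - Y' ⟨i, hi⟩ ⟨j, hj⟩)
          * prefixScalar (f · j) l.castSucc + lam l * (if i = j then f l i else 0) = 0 := by
  have h1 : halfGrad lam Y W l = (Q l.succ).1 *
      (rdiag (d l.succ) (d (Fin.last L)) (fun i => suffixScalar (f · i) l.succ) *
        (rdiag (d (Fin.last L)) (d 0) (fun i => ∏ k, f k i) - Y') *
        rdiag (d 0) (d l.castSucc) (fun i => prefixScalar (f · i) l.castSucc)
        + lam l • rdiag (d l.succ) (d l.castSucc) (f l)) *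
      (Q l.castSucc).1ᵀ := by
    rw [halfGrad, suffixProd_eq_of_factored hf hW, partialProd_eq_of_factored hf hW,
      partialProd_eq_of_factored hf hW, hY, hW]
    simp only [transpose_mul, transpose_transpose, transpose_rdiag, Matrix.mul_sub, Matrix.sub_mul,
      Matrix.mul_add, Matrix.add_mul, Matrix.mul_assoc, transpose_mul_cancel_of_orthogonal,
      Matrix.mul_smul, Matrix.smul_mul, prefixScalar_last]
  have h2 : (0 : Matrix (Fin (d l.succ)) (Fin (d l.castSucc)) ℝ) =
      (Q l.succ).1 * (0 : Matrix (Fin (d l.succ)) (Fin (d l.castSucc)) ℝ) * (Q l.castSucc).1ᵀ := by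
    simp
  rw [h1, h2, orthogonal_cancel_iff, ← Matrix.ext_iff]
  simp only [Matrix.add_apply, mul_rdiag_apply, rdiag_mul_apply, Matrix.smul_apply, rdiag_apply,
    Matrix.sub_apply, Matrix.zero_apply, smul_eq_mul]
  constructor
  · intro h i j hi hj hi' hj'
    have := h ⟨i, hi⟩ ⟨j, hj⟩
    simpa only [dif_pos hi', dif_pos hj'] using this
  · intro h i j
    by_cases hi : (i : ℕ) < d (Fin.last L)
    · by_cases hj : (j : ℕ) < d 0
      · rw [dif_pos hj, dif_pos hi]
        exact h i j i.2 j.2 hi hj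
      · rw [dif_neg hj, zero_add]
        split_ifs with hij
        · rw [hij, hf l 0 _ (not_lt.1 hj), mul_zero]
        · rw [mul_zero]
    · simp only [dif_neg hi, zero_mul, dite_eq_ite, ite_self, zero_add]
      split_ifs with hij
      · rw [hf l _ _ (not_lt.1 hi), mul_zero]
      · rw [mul_zero]

end Factored

/-- A chain of dependent choices along `Fin (n + 1)`. -/
theorem exists_fin_chain {n : ℕ} {X : Fin (n + 1) → Type*}
    (r : (l : Fin n) → X l.castSucc → X l.succ → Prop) (h : ∀ l a, ∃ b, r l a b) (a : X 0) :
    ∃ x : (k : Fin (n + 1)) → X k, ∀ l, r l (x l.castSucc) (x l.succ) := by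
  choose g hg using h
  refine ⟨fun k => Fin.induction (motive := X) a g k, fun l => ?_⟩
  simp only [Fin.induction_succ]
  exact hg l _

/-- A dependent function can be given new values at both ends of `Fin (n + 2)`. -/
theorem exists_fin_update_ends {n : ℕ} {X : Fin (n + 2) → Type*} (f : (k : Fin (n + 2)) → X k)
    (a : X 0) (b : X (Fin.last (n + 1))) :
    ∃ g : (k : Fin (n + 2)) → X k, g 0 = a ∧ g (Fin.last (n + 1)) = b ∧
      ∀ k, k ≠ 0 → k ≠ Fin.last (n + 1) → g k = f k := by
  refine ⟨Function.update (Function.update f 0 a) (Fin.last (n + 1)) b, ?_, ?_, ?_⟩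
  · rw [Function.update_of_ne Fin.last_pos.ne, Function.update_self]
  · rw [Function.update_self]
  · intro k h0 h1
    rw [Function.update_of_ne h1, Function.update_of_ne h0]

/-! ### Simultaneous diagonalization at critical points. -/

section Critical

/-- The weights at a critical point have simultaneous singular value decompositions. -/
theorem exists_factorization_of_halfGrad_eq_zero {L : ℕ} {d : Fin (L + 1 + 1) → ℕ}
    {lam : Fin (L + 1) → ℝ}
    (hlam : ∀ l, 0 < lam l) {Y : Matrix (Fin (d (Fin.last (L + 1)))) (Fin (d 0)) ℝ} {W : Weights d}
    (hW : ∀ l, halfGrad lam Y W l = 0) :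
    ∃ (Q : (k : Fin (L + 1 + 1)) → Matrix.orthogonalGroup (Fin (d k)) ℝ) (t : ℕ → ℝ),
      Antitone t ∧ (∀ i, 0 ≤ t i) ∧ (∀ k i, d k ≤ i → t i = 0) ∧
      ∀ l, W l = (Q l.succ).1 * rdiag (d l.succ) (d l.castSucc) (fun i => t i / √(lam l))
        * (Q l.castSucc).1ᵀ := by
  -- `M k` is attached to the space between two layers; computing it from either neighbour gives the
  -- balance relations `hM1` and `hM2`.
  let M : (k : Fin (L + 1 + 1)) → Matrix (Fin (d k)) (Fin (d k)) ℝ := fun k =>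
    (suffixProd W k)ᵀ * (Y - partialProd W (Fin.last (L + 1))) * (partialProd W k)ᵀ
  have hgrad : ∀ l, (suffixProd W l.succ)ᵀ * (Y - partialProd W (Fin.last (L + 1))) *
      (partialProd W l.castSucc)ᵀ = lam l • W l := by
    intro l
    have := hW l
    rw [halfGrad, ← neg_sub Y, Matrix.mul_neg, Matrix.neg_mul] at this
    exact neg_add_eq_zero.1 this
  have hsqrt : ∀ l, √(lam l) * √(lam l) = lam l := fun l => Real.mul_self_sqrt (hlam l).le
  have hM1 : ∀ l : Fin (L + 1), M l.castSucc = (√(lam l) • W l)ᵀ * (√(lam l) • W l) := by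
    intro l
    simp only [M]
    rw [suffixProd_castSucc, transpose_mul, Matrix.mul_assoc, Matrix.mul_assoc,
      ← Matrix.mul_assoc (suffixProd W l.succ)ᵀ, hgrad]
    simp only [transpose_smul, Matrix.mul_smul, Matrix.smul_mul, smul_smul, hsqrt]
  have hM2 : ∀ l : Fin (L + 1), M l.succ = (√(lam l) • W l) * (√(lam l) • W l)ᵀ := by
    intro l
    simp only [M]
    rw [partialProd_succ, transpose_mul, ← Matrix.mul_assoc, hgrad]
    simp only [transpose_smul, Matrix.mul_smul, Matrix.smul_mul, smul_smul, hsqrt]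
  obtain ⟨Q₀, t, ht, ht0, htn, hQ₀⟩ := exists_gram_eq (√(lam 0) • W 0)
  have hQ₀' : M 0 = Q₀.1 * rdiag _ _ (fun i => t i ^ 2) * Q₀.1ᵀ := (hM1 0).trans hQ₀
  -- The state carried along the chain is an eigenbasis of `M k` for the same `t`, with the bound on
  -- the support of `t` that each width imposes.
  let X : Fin (L + 1 + 1) → Type := fun k => {Q : Matrix.orthogonalGroup (Fin (d k)) ℝ //
    M k = Q.1 * rdiag _ _ (fun i => t i ^ 2) * Q.1ᵀ ∧ ∀ i, d k ≤ i → t i = 0}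
  obtain ⟨x, hx⟩ := exists_fin_chain (X := X)
    (fun l a b => W l = b.1.1 * rdiag (d l.succ) (d l.castSucc) (fun i => t i / √(lam l)) * a.1.1ᵀ) (by
      rintro l ⟨Q, hQ, hQn⟩
      obtain ⟨⟨P, hP⟩, hPn⟩ := exists_orthogonal_mul_rdiag_mul_transpose (√(lam l) • W l) Q ht ht0
        hQn ((hM1 l).symm.trans hQ)
      have hMP : M l.succ = P.1 * rdiag _ _ (fun i => t i ^ 2) * P.1ᵀ := by
        rw [hM2, hP]
        simp only [transpose_mul, transpose_transpose, transpose_rdiag, Matrix.mul_assoc,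
          transpose_mul_cancel_of_orthogonal]
        rw [← Matrix.mul_assoc (rdiag _ _ _),
          rdiag_mul_rdiag fun i hi => by rw [hQn i hi, zero_mul]]
        simp only [sq]
      have hWP : W l = P.1 * rdiag (d l.succ) (d l.castSucc) (fun i => t i / √(lam l)) * Q.1ᵀ := by
        have hne : √(lam l) ≠ 0 := (Real.sqrt_pos.2 (hlam l)).ne'
        have h' : W l = (√(lam l))⁻¹ • (√(lam l) • W l) := by
          rw [smul_smul, inv_mul_cancel₀ hne, one_smul]
        refine h'.trans ?_
        rw [hP, ← Matrix.smul_mul, ← Matrix.mul_smul, smul_rdiag]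
        simp only [div_eq_inv_mul]
      exact ⟨⟨P, hMP, hPn⟩, hWP⟩)
    ⟨Q₀, hQ₀', htn⟩
  exact ⟨fun k => (x k).1, t, ht, ht0, fun k => (x k).2.2, hx⟩

/-- A matrix whose off-diagonal entries vanish in the first `a` rows and columns becomes
diagonal under orthogonal transformations of the remaining coordinates. -/
theorem exists_diagonalization_of_block {a m n : ℕ} (ha : a ≤ m) (ha' : a ≤ n)
    (A : Matrix (Fin m) (Fin n) ℝ)
    (hA : ∀ (i : Fin m) (j : Fin n), ((i : ℕ) < a ∨ (j : ℕ) < a) → (i : ℕ) ≠ j → A i j = 0)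
    (hA0 : ∀ (i : Fin m) (j : Fin n), (i : ℕ) < a → (i : ℕ) = j → 0 ≤ A i j) :
    ∃ (P : Matrix.orthogonalGroup (Fin (m - a)) ℝ) (R : Matrix.orthogonalGroup (Fin (n - a)) ℝ)
      (z : ℕ → ℝ), (∀ i, 0 ≤ z i) ∧
      (∀ (i : Fin m) (j : Fin n), (i : ℕ) < a → (i : ℕ) = j → z i = A i j) ∧
      A = blkD₂ ha ha 1 P.1 * rdiag m n z * (blkD₂ ha' ha' 1 R.1)ᵀ := by
  let c : Fin a → ℝ := fun i => A (splitEquiv ha (Sum.inl i)) (splitEquiv ha' (Sum.inl i))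
  let B : Matrix (Fin (m - a)) (Fin (n - a)) ℝ :=
    Matrix.of fun i j => A (splitEquiv ha (Sum.inr i)) (splitEquiv ha' (Sum.inr j))
  have hB : A = blkD₂ ha ha' (Matrix.diagonal c) B := by
    refine ext_splitEquiv ha ha' fun i j => ?_
    rw [blkD₂_apply]
    rcases i with i | i <;> rcases j with j | j
    · by_cases hij : i = j
      · subst hij; simp [c]
      · simp only [fromBlocks_apply₁₁, diagonal_apply_ne _ hij]
        exact hA _ _ (Or.inl (by simp [splitEquiv_inl]))
          (by simpa [splitEquiv_inl, Fin.ext_iff] using hij)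
    · exact hA _ _ (Or.inl (by simp [splitEquiv_inl]))
        (by simp only [splitEquiv_inl, splitEquiv_inr]; omega)
    · exact hA _ _ (Or.inr (by simp [splitEquiv_inl]))
        (by simp only [splitEquiv_inl, splitEquiv_inr]; omega)
    · rfl
  obtain ⟨P, R, w, hw, hPR⟩ := exists_svd B
  refine ⟨P, R, fun i => if hi : i < a then c ⟨i, hi⟩ else w (i - a), ?_, ?_, ?_⟩
  · intro i
    dsimp only
    split_ifs with hi
    · exact hA0 _ _ (by simpa [splitEquiv_inl] using hi) (by simp [splitEquiv_inl])
    · exact hw _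
  · intro i j hi hij
    dsimp only
    rw [dif_pos hi]
    exact congrArg₂ A (Fin.ext (by simp [splitEquiv_inl]))
      (Fin.ext (by simp [splitEquiv_inl, hij]))
  · rw [← blkD₂_rdiag ha ha', blkD₂_transpose, blkD₂_mul, blkD₂_mul, ← hPR, Matrix.one_mul,
      transpose_one, Matrix.mul_one, ← hB]

theorem rdiag_mul_transpose_of_rdiag_mul {m n : ℕ} {f : ℕ → ℝ}
    (T : Matrix.orthogonalGroup (Fin n) ℝ) (h : rdiag m n f * T.1 = rdiag m n f) :
    rdiag m n f * T.1ᵀ = rdiag m n f := by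
  conv_lhs => rw [← h]
  rw [Matrix.mul_assoc, mul_transpose_self_of_orthogonal, Matrix.mul_one]

/-- This form does not refer to a chosen decomposition of `Y`. Where `t` vanishes the scalar
equation is void, so `z` is unconstrained there apart from its sign. -/
theorem isCriticalPoint_iff_exists_factorization {N : ℕ} {d : Fin (N + 2 + 1) → ℕ}
    {lam : Fin (N + 2) → ℝ} (hlam : ∀ l, 0 < lam l)
    (Y : Matrix (Fin (d (Fin.last (N + 2)))) (Fin (d 0)) ℝ) (W : Weights d) :
    IsCriticalPoint lam Y W ↔
      ∃ (Q : (k : Fin (N + 2 + 1)) → Matrix.orthogonalGroup (Fin (d k)) ℝ) (t z : ℕ → ℝ),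
        Antitone t ∧ (∀ i, 0 ≤ t i) ∧ (∀ k i, d k ≤ i → t i = 0) ∧ (∀ i, 0 ≤ z i) ∧
        (∀ l, W l = (Q l.succ).1 * rdiag (d l.succ) (d l.castSucc) (fun i => t i / √(lam l))
          * (Q l.castSucc).1ᵀ) ∧
        Y = (Q (Fin.last (N + 2))).1 * rdiag (d (Fin.last (N + 2))) (d 0) z * (Q 0).1ᵀ ∧
        ∀ i, t i ^ (2 * (N + 2) - 1) - √(∏ l, lam l) * z i * t i ^ ((N + 2) - 1)
          + (∏ l, lam l) * t i = 0 := by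
  rw [isCriticalPoint_iff]
  constructor
  · intro hcrit
    obtain ⟨Q, t, ht, ht0, htn, hW⟩ := exists_factorization_of_halfGrad_eq_zero hlam hcrit
    have hf : ∀ (l : Fin (N + 2)) k i, d k ≤ i → t i / √(lam l) = 0 := fun l k i hi => by
      rw [htn k i hi, zero_div]
    set Y' := (Q (Fin.last (N + 2))).1ᵀ * Y * (Q 0).1
    have hY : Y = (Q (Fin.last (N + 2))).1 * Y' * (Q 0).1ᵀ := by
      simp only [Y', Matrix.mul_assoc, mul_transpose_self_of_orthogonal, Matrix.mul_one]
      rw [mul_transpose_cancel_of_orthogonal]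
    have hzero : ∃ i, t i = 0 := ⟨d 0, htn 0 _ le_rfl⟩
    classical
    -- Since `t` is decreasing and nonnegative, its first zero `a` counts its positive entries.
    let a := Nat.find hzero
    have had : ∀ k, a ≤ d k := fun k => Nat.find_min' hzero (htn k _ le_rfl)
    have hta : ∀ i, a ≤ i → t i = 0 := fun i hi =>
      le_antisymm ((ht hi).trans (Nat.find_spec hzero).le) (ht0 i)
    have hpos : ∀ i, i < a → 0 < t i := fun i hi => (ht0 i).lt_of_ne' (Nat.find_min hzero hi)
    have hxpos : ∀ i, i < a → ∀ l, 0 < t i / √(lam l) := fun i hi l =>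
      div_pos (hpos i hi) (Real.sqrt_pos.2 (hlam l))
    have hgrad := fun l => (halfGrad_eq_zero_iff_of_factored
      (f := fun l i => t i / √(lam l)) hf hW lam hY l).1 (hcrit l)
    have hoff : ∀ (i : Fin (d (Fin.last (N + 2)))) (j : Fin (d 0)),
        ((i : ℕ) < a ∨ (j : ℕ) < a) → (i : ℕ) ≠ j → Y' i j = 0 := by
      rintro i j (h | h) hij
      -- In the first layer the prefix product is 1, so only positivity of t_i is needed and `j` is
      -- arbitrary. The last layer serves in the same way for positive t_j.
      · have := hgrad 0 i j (h.trans_le (had _)) j.2 i.2 j.2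
        have hs : 0 < suffixScalar (fun l => t i / √(lam l)) (Fin.succ 0) :=
          Finset.prod_pos fun l _ => hxpos i h l
        rw [if_neg hij, if_neg hij, zero_sub, mul_zero, add_zero, Fin.castSucc_zero,
          prefixScalar_zero, mul_one, mul_eq_zero, neg_eq_zero] at this
        exact this.resolve_left hs.ne'
      · have := hgrad (Fin.last (N + 1)) i j i.2 (h.trans_le (had _)) i.2 j.2
        have hs : 0 < prefixScalar (fun l => t j / √(lam l)) (Fin.last (N + 1)).castSucc :=
          Finset.prod_pos fun l _ => hxpos j h l
        rw [if_neg hij, if_neg hij, zero_sub, mul_zero, add_zero, Fin.succ_last,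
          suffixScalar_last, one_mul, mul_eq_zero, neg_eq_zero] at this
        exact this.resolve_right hs.ne'
    have hdiag : ∀ (i : Fin (d (Fin.last (N + 2)))) (j : Fin (d 0)), (i : ℕ) < a → (i : ℕ) = j →
        (∏ k ∈ Finset.univ.erase 0, t i / √(lam k)) * (∏ k, t i / √(lam k) - Y' i j)
        + lam 0 * (t i / √(lam 0)) = 0 := by
      rintro i ⟨j, hj⟩ h hij
      obtain rfl : (i : ℕ) = j := hij
      have := hgrad 0 i i (h.trans_le (had _)) (h.trans_le (had _)) i.2 hj
      rw [if_pos rfl, if_pos rfl] at this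
      rw [← suffixScalar_mul_prefixScalar, mul_right_comm]
      exact this
    obtain ⟨P, R, z, hz, hzY, hYz⟩ := exists_diagonalization_of_block (had (Fin.last (N + 2)))
      (had 0) Y' hoff (by
        -- A negative diagonal entry of `Y'` would make both summands of the scalar equation
        -- positive.
        intro i j h hij
        have h1 := hdiag i j h hij
        have h2 : 0 < ∏ k ∈ Finset.univ.erase 0, t i / √(lam k) :=
          Finset.prod_pos fun k _ => hxpos i h k
        have h3 : 0 < ∏ k, t i / √(lam k) := Finset.prod_pos fun k _ => hxpos i h k
        have h4 := mul_pos (hlam 0) (hxpos i h 0)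
        by_contra! hneg
        have := mul_pos h2 (by linarith : 0 < ∏ k, t i / √(lam k) - Y' i j)
        linarith)
    -- Only the two outer frames are rotated, and only in coordinates from `a` on, where every
    -- weight vanishes.
    obtain ⟨T, hT0, hTlast, hT1⟩ := exists_fin_update_ends
      (X := fun k => Matrix.orthogonalGroup (Fin (d k)) ℝ) (fun _ => 1)
      ⟨blkD₂ (had 0) (had 0) 1 R.1, (blkD₂_mem_orthogonalGroup_iff _ _ _).2 ⟨one_mem _, R.2⟩⟩
      ⟨blkD₂ (had _) (had _) 1 P.1, (blkD₂_mem_orthogonalGroup_iff _ _ _).2 ⟨one_mem _, P.2⟩⟩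
    replace hT0 : (T 0).1 = blkD₂ (had 0) (had 0) 1 R.1 := congrArg Subtype.val hT0
    replace hTlast : (T (Fin.last (N + 2))).1 = blkD₂ (had _) (had _) 1 P.1 :=
      congrArg Subtype.val hTlast
    have hT : ∀ k m (f : ℕ → ℝ), (∀ i, a ≤ i → f i = 0) →
        rdiag m (d k) f * (T k).1 = rdiag m (d k) f := by
      intro k m f hf
      rcases eq_or_ne k (Fin.last (N + 2)) with rfl | h1
      · rw [hTlast, rdiag_mul_blkD₂ _ _ hf]
      · rcases eq_or_ne k 0 with rfl | h2
        · rw [hT0, rdiag_mul_blkD₂ _ _ hf]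
        · rw [hT1 k h2 h1]
          exact Matrix.mul_one _
    have hT' : ∀ k m (f : ℕ → ℝ), (∀ i, a ≤ i → f i = 0) →
        (T k).1 * rdiag (d k) m f = rdiag (d k) m f := by
      intro k m f hf
      have := congrArg transpose (rdiag_mul_transpose_of_rdiag_mul (T k) (hT k m f hf))
      simpa only [transpose_mul, transpose_transpose, transpose_rdiag] using this
    refine ⟨fun k => Q k * T k, t, z, ht, ht0, htn, hz, ?_, ?_, ?_⟩
    · intro l
      have hfa : ∀ i, a ≤ i → t i / √(lam l) = 0 := fun i hi => by rw [hta i hi, zero_div]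
      rw [hW l]
      change _ = ((Q l.succ).1 * (T l.succ).1) * _ * ((Q l.castSucc).1 * (T l.castSucc).1)ᵀ
      rw [transpose_mul, Matrix.mul_assoc (Q l.succ).1 (T l.succ).1, hT' _ _ _ hfa,
        ← Matrix.mul_assoc _ (T l.castSucc).1ᵀ, Matrix.mul_assoc (Q l.succ).1 _ (T l.castSucc).1ᵀ,
        rdiag_mul_transpose_of_rdiag_mul _ (hT _ _ _ hfa)]
    · conv_lhs => rw [hY, hYz, ← hT0, ← hTlast]
      change _ = ((Q (Fin.last (N + 2))).1 * (T (Fin.last (N + 2))).1) * _ *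
        ((Q 0).1 * (T 0).1)ᵀ
      simp only [transpose_mul, Matrix.mul_assoc]
    · intro i
      by_cases hi : i < a
      · have h := hdiag ⟨i, hi.trans_le (had _)⟩ ⟨i, hi.trans_le (had _)⟩ hi rfl
        rw [← hzY _ _ hi rfl] at h
        exact (scalar_equation_iff_of_pos hlam (hpos i hi) _ 0).1 h
      · rw [hta i (not_lt.1 hi), zero_pow (by omega), zero_pow (by omega)]
        ring
  · rintro ⟨Q, t, z, -, ht0, htn, -, hW, hY, hpoly⟩ l
    have hf : ∀ (l : Fin (N + 2)) k i, d k ≤ i → t i / √(lam l) = 0 := fun l k i hi => by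
      rw [htn k i hi, zero_div]
    rw [halfGrad_eq_zero_iff_of_factored (f := fun l i => t i / √(lam l)) hf hW lam hY l]
    intro i j _ _ hi' hj'
    rw [rdiag_apply]
    by_cases hij : i = j
    · subst hij
      simp only [if_true]
      rw [mul_right_comm, suffixScalar_mul_prefixScalar]
      exact scalar_equation hlam (ht0 i) (hpoly i) l
    · simp [hij]

end Critical

/-! ### Permutations and uniqueness of singular values. -/

section Permutation

/-- Two families with the same multiset of values agree up to a permutation. -/
theorem exists_perm_of_map_eq {n : ℕ} {α : Type*} {f g : Fin n → α}
    (h : Multiset.map f Finset.univ.val = Multiset.map g Finset.univ.val) :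
    ∃ π : Equiv.Perm (Fin n), ∀ i, f i = g (π i) := by
  classical
  have hcard : ∀ c, Fintype.card {a // f a = c} = Fintype.card {a // g a = c} := by
    intro c
    have := congrArg (Multiset.count c) h
    rw [Multiset.count_map, Multiset.count_map] at this
    rw [Fintype.card_subtype, Fintype.card_subtype]
    simpa only [Finset.card, Finset.filter, eq_comm] using this
  exact ⟨Equiv.ofFiberEquiv fun c => Fintype.equivOfCardEq (hcard c),
    fun i => (Equiv.ofFiberEquiv_map _ i).symm⟩

theorem permMatrix_mem_orthogonalGroup {n : ℕ} (π : Equiv.Perm (Fin n)) :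
    π.permMatrix ℝ ∈ Matrix.orthogonalGroup (Fin n) ℝ := by
  rw [Matrix.mem_orthogonalGroup_iff, transpose_permMatrix, ← permMatrix_mul, inv_mul_cancel,
    permMatrix_one]

theorem permMatrix_mul_diagonal {n : ℕ} (π : Equiv.Perm (Fin n)) (y : Fin n → ℝ) :
    π.permMatrix ℝ * Matrix.diagonal y = Matrix.diagonal (fun i => y (π i)) * π.permMatrix ℝ := by
  ext i j
  simp only [mul_diagonal, diagonal_mul, Equiv.Perm.permMatrix, PEquiv.toMatrix_apply,
    Equiv.toPEquiv_apply, Option.mem_def, Option.some.injEq]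
  split_ifs with h
  · rw [h, mul_comm]
  · simp

variable {k m n : ℕ}

/-- The matrix `BlkD(Π, I)` as an orthogonal matrix. -/
def permBlock (h : k ≤ m) (π : Equiv.Perm (Fin k)) : Matrix.orthogonalGroup (Fin m) ℝ :=
  ⟨blkD₂ h h (π.permMatrix ℝ) 1, (blkD₂_mem_orthogonalGroup_iff _ _ _).2
    ⟨permMatrix_mem_orthogonalGroup π, one_mem _⟩⟩

theorem permBlock_mul_blkD₂ (hm : k ≤ m) (hn : k ≤ n) (π : Equiv.Perm (Fin k)) (y : Fin k → ℝ) :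
    (permBlock hm π).1 * blkD₂ hm hn (Matrix.diagonal y) 0 =
      blkD₂ hm hn (Matrix.diagonal fun i => y (π i)) 0 * (permBlock hn π).1 := by
  simp only [permBlock, blkD₂_mul, permMatrix_mul_diagonal, Matrix.one_mul, Matrix.mul_one]

/-- The singular values of a matrix are unique up to a permutation. -/
theorem exists_perm_of_svd_eq (hm : k ≤ m) (hn : k ≤ n)
    {P U : Matrix.orthogonalGroup (Fin m) ℝ} {R V : Matrix.orthogonalGroup (Fin n) ℝ}
    {z y : Fin k → ℝ} (hz : ∀ i, 0 ≤ z i) (hy : ∀ i, 0 ≤ y i)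
    (h : P.1 * blkD₂ hm hn (Matrix.diagonal z) 0 * R.1ᵀ =
      U.1 * blkD₂ hm hn (Matrix.diagonal y) 0 * V.1ᵀ) :
    ∃ π : Equiv.Perm (Fin k), ∀ i, z i = y (π i) := by
  -- The characteristic polynomial of the Gram matrix sees only the squared singular values; the
  -- factor from the zero block is common to both decompositions and cancels.
  have key : ∀ (P : Matrix.orthogonalGroup (Fin m) ℝ) (R : Matrix.orthogonalGroup (Fin n) ℝ)
      (z : Fin k → ℝ), ((P.1 * blkD₂ hm hn (Matrix.diagonal z) 0 * R.1ᵀ) *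
        (P.1 * blkD₂ hm hn (Matrix.diagonal z) 0 * R.1ᵀ)ᵀ).charpoly =
      (∏ i, (Polynomial.X - Polynomial.C (z i ^ 2))) *
        (0 : Matrix (Fin (m - k)) (Fin (m - k)) ℝ).charpoly := by
    intro P R z
    simp only [transpose_mul, transpose_transpose, Matrix.mul_assoc,
      transpose_mul_cancel_of_orthogonal]
    rw [← Matrix.mul_assoc (blkD₂ hm hn _ _), blkD₂_transpose, blkD₂_mul, charpoly_mul_comm,
      Matrix.mul_assoc, transpose_mul_self_of_orthogonal, Matrix.mul_one, blkD₂,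
      charpoly_reindex, charpoly_fromBlocks_zero₁₂, diagonal_transpose, diagonal_mul_diagonal,
      charpoly_diagonal, Matrix.zero_mul]
    simp only [sq]
  have h1 := key P R z
  rw [h, key U V y] at h1
  have h2 := mul_right_cancel₀ (charpoly_monic _).ne_zero h1
  have h3 : Multiset.map (fun i => y i ^ 2) Finset.univ.val =
      Multiset.map (fun i => z i ^ 2) Finset.univ.val := by
    have hroots : ∀ w : Fin k → ℝ, (∏ i, (Polynomial.X - Polynomial.C (w i))).roots =
        Multiset.map w Finset.univ.val := fun w => by
      rw [← Polynomial.roots_multiset_prod_X_sub_C (Multiset.map w Finset.univ.val),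
        Multiset.map_map]
      rfl
    rw [← hroots, ← hroots, h2]
  obtain ⟨π, hπ⟩ := exists_perm_of_map_eq h3.symm
  exact ⟨π, fun i => by simpa [hz, hy] using congrArg Real.sqrt (hπ i)⟩

end Permutation

/-! ### Blocks of equal singular values. -/

section Grouping

variable {n r p : ℕ} {y : Fin n → ℝ} {s : Fin (p + 1) → ℕ}

theorem blkD_apply {h : Fin p → ℕ} (hr : ∑ k, h k = r)
    (X : (k : Fin p) → Matrix (Fin (h k)) (Fin (h k)) ℝ) (i j) :
    blkD hr X (finSigmaFinEquiv.trans (finCongr hr) i) (finSigmaFinEquiv.trans (finCongr hr) j) =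
      Matrix.blockDiagonal' X i j := by
  simp [blkD]

theorem blkD_transpose {h : Fin p → ℕ} (hr : ∑ k, h k = r)
    (X : (k : Fin p) → Matrix (Fin (h k)) (Fin (h k)) ℝ) :
    (blkD hr X)ᵀ = blkD hr fun k => (X k)ᵀ := by
  simp [blkD, transpose_submatrix, blockDiagonal'_transpose]

theorem blkD_mem_orthogonalGroup_iff {h : Fin p → ℕ} (hr : ∑ k, h k = r)
    (X : (k : Fin p) → Matrix (Fin (h k)) (Fin (h k)) ℝ) :
    blkD hr X ∈ Matrix.orthogonalGroup (Fin r) ℝ ↔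
      ∀ k, X k ∈ Matrix.orthogonalGroup (Fin (h k)) ℝ := by
  have h1 : blkD hr X * (blkD hr X)ᵀ = blkD hr fun k => X k * (X k)ᵀ := by
    rw [blkD_transpose, blkD, blkD, blkD, blockDiagonal'_mul]
    simp only [reindex_apply, submatrix_mul_equiv]
  have h2 : (1 : Matrix (Fin r) (Fin r) ℝ) =
      blkD hr (1 : (k : Fin p) → Matrix (Fin (h k)) (Fin (h k)) ℝ) := by
    rw [blkD, blockDiagonal'_one, reindex_apply, submatrix_one_equiv]
  simp only [Matrix.mem_orthogonalGroup_iff]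
  rw [h1, h2]
  constructor
  · intro h k
    exact congrFun (blockDiagonal'_injective ((Matrix.reindex _ _).injective h)) k
  · intro h
    rw [funext h]
    rfl

namespace IsGrouping

/-- The sizes of the preceding blocks telescope: apply `sum_mult_add` to `s` cut off at `k`. -/
theorem sigma_equiv_val (hs : IsGrouping y r s) (k : Fin p) (a : Fin (mult s k)) :
    ((finSigmaFinEquiv.trans (finCongr hs.sum_mult) ⟨k, a⟩ : Fin r) : ℕ) = s k.castSucc + a := by
  have hk : (k : ℕ) + 1 ≤ p + 1 := by omega
  have h := sum_mult_add (p := k) (fun i => s (Fin.castLE hk i))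
    (hs.strictMono.monotone.comp (Fin.strictMono_castLE hk).monotone)
  have h0 : s (Fin.castLE hk 0) = 0 := hs.first
  rw [h0, add_zero] at h
  rw [Equiv.trans_apply, finCongr_apply, Fin.val_cast, finSigmaFinEquiv_apply]
  congr 1

theorem eq_iff_fst_eq (hs : IsGrouping y r s) (hr : r ≤ n) (i j : (k : Fin p) × Fin (mult s k)) :
    y (Fin.castLE hr (finSigmaFinEquiv.trans (finCongr hs.sum_mult) i)) =
      y (Fin.castLE hr (finSigmaFinEquiv.trans (finCongr hs.sum_mult) j)) ↔ i.1 = j.1 := by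
  have hlt : ∀ i j : (k : Fin p) × Fin (mult s k), i.1 < j.1 →
      y (Fin.castLE hr (finSigmaFinEquiv.trans (finCongr hs.sum_mult) j)) <
        y (Fin.castLE hr (finSigmaFinEquiv.trans (finCongr hs.sum_mult) i)) := by
    rintro ⟨k, a⟩ ⟨l, b⟩ hkl
    have h1 : s k.succ ≤ s l.castSucc := hs.strictMono.monotone (by
      simp only [Fin.le_def, Fin.lt_def, Fin.val_succ, Fin.val_castSucc] at hkl ⊢; omega)
    have h2 := a.2
    have h3 : mult s k = s k.succ - s k.castSucc := rfl
    refine hs.gt_of_later_group k _ _ ?_ ?_ <;> rw [Fin.val_castLE, hs.sigma_equiv_val] <;> omega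
  constructor
  · intro h
    rcases lt_trichotomy i.1 j.1 with h' | h' | h'
    · exact absurd h (hlt _ _ h').ne'
    · exact h'
    · exact absurd h (hlt _ _ h').ne
  · rcases i with ⟨k, a⟩
    rcases j with ⟨l, b⟩
    rintro (rfl : k = l)
    have h1 := a.2
    have h2 := b.2
    have h3 : mult s k = s k.succ - s k.castSucc := rfl
    refine hs.eq_of_same_group k _ _ ?_ ?_ ?_ ?_ <;> rw [Fin.val_castLE, hs.sigma_equiv_val] <;>
      omega

theorem diagonal_eq_blkD₂ (hs : IsGrouping y r s) (hr : r ≤ n) {m m' : ℕ} (hm : n ≤ m)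
    (hm' : n ≤ m') : blkD₂ hm hm' (Matrix.diagonal y) 0 =
      blkD₂ (hr.trans hm) (hr.trans hm') (Matrix.diagonal fun i => y (Fin.castLE hr i)) 0 := by
  rw [blkD₂_zero_eq_rdiag, blkD₂_zero_eq_rdiag]
  congr 1
  ext i
  by_cases h : i < r
  · rw [dif_pos h, dif_pos (h.trans_le hr)]
    rfl
  · rw [dif_neg h]
    split_ifs
    · exact hs.eq_zero _ (not_lt.1 h)
    · rfl

/-- Block diagonal matrices with blocks given by the groups commute with `Σ_Y`. -/
theorem diagonal_mul_blkD (hs : IsGrouping y r s) (hr : r ≤ n) {m m' : ℕ} (hm : n ≤ m)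
    (hm' : n ≤ m') (X : (k : Fin p) → Matrix (Fin (mult s k)) (Fin (mult s k)) ℝ)
    (X' : Matrix (Fin (m' - r)) (Fin (m' - r)) ℝ) (X'' : Matrix (Fin (m - r)) (Fin (m - r)) ℝ) :
    blkD₂ hm hm' (Matrix.diagonal y) 0 *
        blkD₂ (hr.trans hm') (hr.trans hm') (blkD hs.sum_mult X) X' =
      blkD₂ (hr.trans hm) (hr.trans hm) (blkD hs.sum_mult X) X'' *
        blkD₂ hm hm' (Matrix.diagonal y) 0 := by
  rw [hs.diagonal_eq_blkD₂ hr, blkD₂_mul, blkD₂_mul, Matrix.zero_mul, Matrix.mul_zero]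
  congr 1
  ext i j
  rw [diagonal_mul, mul_diagonal]
  obtain ⟨i, rfl⟩ := (finSigmaFinEquiv.trans (finCongr hs.sum_mult)).surjective i
  obtain ⟨j, rfl⟩ := (finSigmaFinEquiv.trans (finCongr hs.sum_mult)).surjective j
  rw [blkD_apply, blockDiagonal'_apply]
  split_ifs with h
  · rw [(hs.eq_iff_fst_eq hr i j).2 h, mul_comm]
  · simp

theorem exists_blkD_eq (hs : IsGrouping y r s) (hr : r ≤ n) (A : Matrix (Fin r) (Fin r) ℝ)
    (hA : ∀ i j, y (Fin.castLE hr i) ≠ y (Fin.castLE hr j) → A i j = 0) :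
    ∃ X : (k : Fin p) → Matrix (Fin (mult s k)) (Fin (mult s k)) ℝ, A = blkD hs.sum_mult X := by
  refine ⟨fun k => Matrix.of fun a b => A (finSigmaFinEquiv.trans (finCongr hs.sum_mult) ⟨k, a⟩)
    (finSigmaFinEquiv.trans (finCongr hs.sum_mult) ⟨k, b⟩), ?_⟩
  ext i j
  obtain ⟨i, rfl⟩ := (finSigmaFinEquiv.trans (finCongr hs.sum_mult)).surjective i
  obtain ⟨j, rfl⟩ := (finSigmaFinEquiv.trans (finCongr hs.sum_mult)).surjective j
  rw [blkD_apply, blockDiagonal'_apply]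
  split_ifs with h
  · rcases i with ⟨k, a⟩
    rcases j with ⟨l, b⟩
    obtain rfl : k = l := h
    rfl
  · exact hA _ _ fun h' => h ((hs.eq_iff_fst_eq hr i j).1 h')

/-- Orthogonal matrices intertwined by `Σ_Y` are block diagonal, with the same blocks on the
groups of equal positive singular values. -/
theorem exists_blocks_of_intertwining (hs : IsGrouping y r s) (hr : r ≤ n) (hy : ∀ i, 0 ≤ y i)
    {m m' : ℕ} (hm : n ≤ m) (hm' : n ≤ m') (E : Matrix.orthogonalGroup (Fin m) ℝ)
    (B : Matrix.orthogonalGroup (Fin m') ℝ)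
    (h : blkD₂ hm hm' (Matrix.diagonal y) 0 * B.1 = E.1 * blkD₂ hm hm' (Matrix.diagonal y) 0) :
    ∃ (O : (k : Fin p) → Matrix.orthogonalGroup (Fin (mult s k)) ℝ)
      (O' : Matrix.orthogonalGroup (Fin (m' - r)) ℝ) (Ohat : Matrix.orthogonalGroup (Fin (m - r)) ℝ),
      B.1 = blkD₂ (hr.trans hm') (hr.trans hm') (blkD hs.sum_mult fun k => (O k).1) O'.1 ∧
      E.1 = blkD₂ (hr.trans hm) (hr.trans hm) (blkD hs.sum_mult fun k => (O k).1) Ohat.1 := by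
  let f : ℕ → ℝ := fun i => if hi : i < n then y ⟨i, hi⟩ else 0
  have hf : ∀ i, n ≤ i → f i = 0 := fun i hi => dif_neg (not_lt.2 hi)
  have hfr : ∀ i, r ≤ i → f i = 0 := fun i hi => by
    simp only [f]
    split_ifs
    · exact hs.eq_zero _ hi
    · rfl
  have hf0 : ∀ i, 0 ≤ f i := fun i => by
    simp only [f]
    split_ifs
    · exact hy _
    · rfl
  have hfpos : ∀ i, i < r → 0 < f i := fun i hi => by
    simp only [f]
    rw [dif_pos (hi.trans_le hr)]
    exact hs.pos _ hi
  rw [blkD₂_zero_eq_rdiag] at h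
  change rdiag m m' f * B.1 = E.1 * rdiag m m' f at h
  -- Transposing the relation and using orthogonality intertwines the transposed diagonal as well.
  have h' : rdiag m' m f * E.1 = B.1 * rdiag m' m f := by
    have := congrArg (fun X => B.1 * Xᵀ * E.1) h
    simpa only [transpose_mul, transpose_rdiag, ← Matrix.mul_assoc,
      mul_transpose_self_of_orthogonal, Matrix.one_mul,
      Matrix.mul_assoc _ _ E.1, transpose_mul_self_of_orthogonal, Matrix.mul_one] using this
  -- Combining both relations, `B` commutes with the squared diagonal. Nonnegative numbers with
  -- equal squares are equal, so `B` cannot couple different values. The sizes are generic in order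
  -- to treat `E` with the roles exchanged.
  have hcomm : ∀ {m m' : ℕ}, n ≤ m → n ≤ m' → ∀ (E : Matrix (Fin m) (Fin m) ℝ)
      (B : Matrix (Fin m') (Fin m') ℝ), rdiag m m' f * B = E * rdiag m m' f →
      rdiag m' m f * E = B * rdiag m' m f → ∀ i j : Fin m', f i ≠ f j → B i j = 0 := by
    intro m m' hm hm' E B h h' i j hij
    have h1 : rdiag m' m' (fun i => f i * f i) * B = B * rdiag m' m' (fun i => f i * f i) := by
      rw [← rdiag_mul_rdiag (n := m) fun i hi => by rw [hf i (hm.trans hi), zero_mul],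
        Matrix.mul_assoc, h, ← Matrix.mul_assoc, h', Matrix.mul_assoc]
    have h2 := congrFun (congrFun h1 i) j
    rw [rdiag_mul_apply, mul_rdiag_apply, dif_pos i.2, dif_pos j.2] at h2
    have h3 : (f i * f i - f j * f j) * B i j = 0 := by linear_combination h2
    refine (mul_eq_zero.1 h3).resolve_left fun h4 => hij ?_
    exact (mul_self_inj (hf0 _) (hf0 _)).1 (sub_eq_zero.1 h4)
  have hB := hcomm hm hm' E.1 B.1 h h'
  have hE := hcomm hm' hm B.1 E.1 h' h
  have hrm := hr.trans hm
  have hrm' := hr.trans hm'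
  have hblocks : ∀ {m : ℕ} (hm : r ≤ m) (B : Matrix (Fin m) (Fin m) ℝ),
      (∀ i j : Fin m, f i ≠ f j → B i j = 0) → B = blkD₂ hm hm
        (Matrix.of fun i j => B (splitEquiv hm (Sum.inl i)) (splitEquiv hm (Sum.inl j)))
        (Matrix.of fun i j => B (splitEquiv hm (Sum.inr i)) (splitEquiv hm (Sum.inr j))) := by
    intro m hm B hB
    refine ext_splitEquiv hm hm fun i j => ?_
    rw [blkD₂_apply]
    rcases i with i | i <;> rcases j with j | j
    · rfl
    · refine hB _ _ ?_
      rw [splitEquiv_inl, splitEquiv_inr, hfr _ (Nat.le_add_right _ _)]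
      exact (hfpos _ i.2).ne'
    · refine hB _ _ ?_
      rw [splitEquiv_inl, splitEquiv_inr, hfr _ (Nat.le_add_right _ _)]
      exact (hfpos _ j.2).ne
    · rfl
  have hB2 := hblocks hrm' B.1 hB
  have hE2 := hblocks hrm E.1 hE
  have hval : ∀ i : Fin r, f i = y (Fin.castLE hr i) := fun i => dif_pos (i.2.trans_le hr)
  obtain ⟨X, hX⟩ := hs.exists_blkD_eq hr (Matrix.of fun i j =>
    B.1 (splitEquiv hrm' (Sum.inl i)) (splitEquiv hrm' (Sum.inl j))) (by
      intro i j hij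
      refine hB _ _ ?_
      rw [splitEquiv_inl, splitEquiv_inl, hval, hval]
      exact hij)
  -- Within a group the intertwining relation compares the entries of `B` and `E` up to a common
  -- positive factor; across groups both vanish.
  have hEB : (Matrix.of fun i j =>
      E.1 (splitEquiv hrm (Sum.inl i)) (splitEquiv hrm (Sum.inl j))) = blkD hs.sum_mult X := by
    rw [← hX]
    ext i j
    rw [of_apply, of_apply]
    by_cases hij : f i = f j
    · have h1 := congrFun (congrFun h (splitEquiv hrm (Sum.inl i))) (splitEquiv hrm' (Sum.inl j))
      rw [rdiag_mul_apply, mul_rdiag_apply] at h1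
      simp only [splitEquiv_inl] at h1
      rw [dif_pos (i.2.trans_le hrm'), dif_pos (j.2.trans_le hrm), ← hij, mul_comm] at h1
      have h2 := mul_right_cancel₀ (hfpos i i.2).ne' h1
      have e1 : (⟨i, i.2.trans_le hrm'⟩ : Fin m') = splitEquiv hrm' (Sum.inl i) :=
        Fin.ext (splitEquiv_inl hrm' i).symm
      have e2 : (⟨j, j.2.trans_le hrm⟩ : Fin m) = splitEquiv hrm (Sum.inl j) :=
        Fin.ext (splitEquiv_inl hrm j).symm
      rw [← e1, ← e2]
      exact h2.symm
    · rw [hB _ _ (by rwa [splitEquiv_inl, splitEquiv_inl]),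
        hE _ _ (by rwa [splitEquiv_inl, splitEquiv_inl])]
  rw [hX] at hB2
  rw [hEB] at hE2
  have hBo := B.2
  have hEo := E.2
  rw [hB2, blkD₂_mem_orthogonalGroup_iff, blkD_mem_orthogonalGroup_iff] at hBo
  rw [hE2, blkD₂_mem_orthogonalGroup_iff] at hEo
  exact ⟨fun k => ⟨X k, hBo.1 k⟩, ⟨_, hBo.2⟩, ⟨_, hEo.2⟩, hB2, hE2⟩

end IsGrouping

end Grouping

/-! ### The matrices Σ_l as rectangular diagonals. -/

section SigmaMat

variable {L : ℕ} {d : Fin (L + 1) → ℕ}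

theorem sigmaMat_eq_rdiag (c : ℝ) (σ : Fin (dMin d) → ℝ) (k j : Fin (L + 1)) :
    sigmaMat c σ k j = rdiag (d k) (d j)
      fun i => (if h : i < dMin d then σ ⟨i, h⟩ else 0) / √c := by
  rw [sigmaMat, blkD₂_zero_eq_rdiag]
  congr 1
  ext i
  split_ifs
  · rfl
  · rw [zero_div]

theorem exists_dMin_eq (d : Fin (L + 1) → ℕ) : ∃ k, dMin d = d k := by
  obtain ⟨k, -, hk⟩ := Finset.exists_mem_eq_inf' ⟨0, Finset.mem_univ 0⟩ d
  exact ⟨k, hk⟩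

/-- The minimum d_min is attained by some width, so `t` already vanishes from d_min on and
restricting it loses nothing. -/
theorem sigmaMat_restrict {t : ℕ → ℝ} (ht : ∀ k i, d k ≤ i → t i = 0) (c : ℝ)
    (k j : Fin (L + 1)) : sigmaMat c (fun i : Fin (dMin d) => t i) k j =
      rdiag (d k) (d j) fun i => t i / √c := by
  obtain ⟨k₀, hk₀⟩ := exists_dMin_eq d
  rw [sigmaMat_eq_rdiag]
  congr 1
  ext i
  split_ifs with h
  · rfl
  · rw [ht k₀ i (hk₀ ▸ not_lt.1 h)]

end SigmaMat

/-- Orthogonal matrices give another singular value decomposition of `Y`, with permuted singular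
values, if and only if they differ from the given ones by a permutation and by blocks. -/
theorem IsSVD.eq_iff_exists_blocks {L : ℕ} {d : Fin (L + 1) → ℕ}
    {Y : Matrix (Fin (d (Fin.last L))) (Fin (d 0)) ℝ}
    {U : Matrix (Fin (d (Fin.last L))) (Fin (d (Fin.last L))) ℝ}
    {y : Fin (dY d) → ℝ} {V : Matrix (Fin (d 0)) (Fin (d 0)) ℝ} (hY : IsSVD Y U y V)
    {p : ℕ} {s : Fin (p + 1) → ℕ} (hs : IsGrouping y Y.rank s)
    (P : Matrix.orthogonalGroup (Fin (d (Fin.last L))) ℝ)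
    (R : Matrix.orthogonalGroup (Fin (d 0)) ℝ) (π : Equiv.Perm (Fin (dY d))) :
    Y = P.1 * blkD₂ (dY_le_last d) (dY_le_zero d) (Matrix.diagonal fun i => y (π i)) 0 * R.1ᵀ ↔
      ∃ (O : (k : Fin p) → Matrix.orthogonalGroup (Fin (mult s k)) ℝ)
        (O' : Matrix.orthogonalGroup (Fin (d 0 - Y.rank)) ℝ)
        (Ohat : Matrix.orthogonalGroup (Fin (d (Fin.last L) - Y.rank)) ℝ),
        R.1ᵀ = blkD₂ (dY_le_zero d) (dY_le_zero d) (π.permMatrix ℝ) 1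
            * blkD₂ (rank_le_cols Y) (rank_le_cols Y) (blkD hs.sum_mult fun k => (O k).1) O'.1
            * Vᵀ ∧
        P.1 = U * blkD₂ (rank_le_rows Y) (rank_le_rows Y)
              (blkD hs.sum_mult fun k => (O k).1ᵀ) Ohat.1ᵀ
            * blkD₂ (dY_le_last d) (dY_le_last d) (π.permMatrix ℝ)ᵀ 1 := by
  have hr : Y.rank ≤ dY d := le_min (rank_le_cols Y) (rank_le_rows Y)
  set S := blkD₂ (dY_le_last d) (dY_le_zero d) (Matrix.diagonal y) 0
  let P0 := permBlock (dY_le_zero d) π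
  let PL := permBlock (dY_le_last d) π
  let U' : Matrix.orthogonalGroup (Fin (d (Fin.last L))) ℝ := ⟨U, hY.left_orthogonal⟩
  let V' : Matrix.orthogonalGroup (Fin (d 0)) ℝ := ⟨V, hY.right_orthogonal⟩
  have hS : PL.1 * S = blkD₂ (dY_le_last d) (dY_le_zero d) (Matrix.diagonal fun i => y (π i)) 0
      * P0.1 := permBlock_mul_blkD₂ _ _ π y
  set Z := blkD₂ (dY_le_last d) (dY_le_zero d) (Matrix.diagonal fun i => y (π i)) 0
  have hYS : Y = U'.1 * S * V'.1ᵀ := hY.eq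
  have hPLt : PL.1ᵀ = blkD₂ (dY_le_last d) (dY_le_last d) (π.permMatrix ℝ)ᵀ 1 := by
    rw [show PL.1 = blkD₂ _ _ (π.permMatrix ℝ) 1 from rfl, blkD₂_transpose, transpose_one]
  have hSZ : S = PL.1ᵀ * Z * P0.1 := by
    rw [Matrix.mul_assoc, ← hS, transpose_mul_cancel_of_orthogonal]
  constructor
  · intro h
    obtain ⟨O, O', Ohat, hB, hE⟩ := hs.exists_blocks_of_intertwining hr hY.nonneg
      (dY_le_last d) (dY_le_zero d) (orthTranspose PL * orthTranspose P * U')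
      (orthTranspose P0 * orthTranspose R * V') (by
        -- Once the permutation is undone, the transition matrices between the two pairs of frames
        -- intertwine Σ_Y.
        change S * (P0.1ᵀ * R.1ᵀ * V'.1) = (PL.1ᵀ * P.1ᵀ * U'.1) * S
        have h1 : U'.1 * S = P.1 * Z * R.1ᵀ * V'.1 := by
          rw [← h, hYS, Matrix.mul_assoc, transpose_mul_self_of_orthogonal, Matrix.mul_one]
        rw [Matrix.mul_assoc _ U'.1, h1, hSZ]
        simp only [Matrix.mul_assoc, mul_transpose_cancel_of_orthogonal,
          transpose_mul_cancel_of_orthogonal])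
    replace hB : P0.1ᵀ * R.1ᵀ * V'.1 = _ := hB
    replace hE : PL.1ᵀ * P.1ᵀ * U'.1 = _ := hE
    refine ⟨O, O', Ohat, ?_, ?_⟩
    · rw [← hB]
      change _ = P0.1 * _ * V'.1ᵀ
      simp only [Matrix.mul_assoc, mul_transpose_cancel_of_orthogonal,
        mul_transpose_self_of_orthogonal, Matrix.mul_one]
    · rw [← hPLt, ← blkD_transpose, ← blkD₂_transpose, ← hE]
      change _ = U'.1 * _ * PL.1ᵀ
      simp only [transpose_mul, transpose_transpose, Matrix.mul_assoc,
        mul_transpose_cancel_of_orthogonal, mul_transpose_self_of_orthogonal, Matrix.mul_one]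
  · rintro ⟨O, O', Ohat, hR, hP⟩
    have hD := hs.diagonal_mul_blkD hr (dY_le_last d) (dY_le_zero d) (fun k => (O k).1) O'.1 Ohat.1
    have hE : blkD₂ (rank_le_rows Y) (rank_le_rows Y) (blkD hs.sum_mult fun k => (O k).1) Ohat.1 ∈
        Matrix.orthogonalGroup (Fin (d (Fin.last L))) ℝ :=
      (blkD₂_mem_orthogonalGroup_iff _ _ _).2
        ⟨(blkD_mem_orthogonalGroup_iff _ _).2 fun k => (O k).2, Ohat.2⟩
    let E : Matrix.orthogonalGroup (Fin (d (Fin.last L))) ℝ := ⟨_, hE⟩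
    rw [hR, hP, ← hPLt, ← blkD_transpose, ← blkD₂_transpose]
    change _ = U'.1 * E.1ᵀ * PL.1ᵀ * Z * (P0.1 * _ * V'.1ᵀ)
    calc Y = U'.1 * S * V'.1ᵀ := hYS
      _ = U'.1 * (E.1ᵀ * (E.1 * S)) * V'.1ᵀ := by rw [transpose_mul_cancel_of_orthogonal]
      _ = U'.1 * (E.1ᵀ * (S * blkD₂ (rank_le_cols Y) (rank_le_cols Y)
          (blkD hs.sum_mult fun k => (O k).1) O'.1)) * V'.1ᵀ := by rw [← hD]
      _ = _ := by
        rw [hSZ]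
        simp only [Matrix.mul_assoc]

end DMF

/-- Here `L = N + 2` is the number of layers. The matrix `Q k` acts on `ℝ^{d_k}`, so it is
usually written `Q_{k+1}`; the two outer ones, `Q 0` and `Q (Fin.last _)`, do not occur in the formulas. -/
theorem theorem2p1 {N : ℕ} (d : Fin (N + 2 + 1) → ℕ) (lam : Fin (N + 2) → ℝ)
    (hlam : ∀ l, 0 < lam l)
    (Y : Matrix (Fin (d (Fin.last (N + 2)))) (Fin (d 0)) ℝ)
    (U : Matrix (Fin (d (Fin.last (N + 2)))) (Fin (d (Fin.last (N + 2)))) ℝ)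
    (y : Fin (dY d) → ℝ) (V : Matrix (Fin (d 0)) (Fin (d 0)) ℝ) (hY : IsSVD Y U y V)
    {p : ℕ} (s : Fin (p + 1) → ℕ) (hs : IsGrouping y Y.rank s)
    (W : Weights d) :
    IsCriticalPoint lam Y W ↔
      ∃ (Q : (k : Fin (N + 2 + 1)) → Matrix.orthogonalGroup (Fin (d k)) ℝ)
        (O : (k : Fin p) → Matrix.orthogonalGroup (Fin (mult s k)) ℝ)
        (O' : Matrix.orthogonalGroup (Fin (d 0 - Y.rank)) ℝ)
        (Ohat : Matrix.orthogonalGroup (Fin (d (Fin.last (N + 2)) - Y.rank)) ℝ)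
        (σ : Fin (dMin d) → ℝ) (π : Equiv.Perm (Fin (dY d))),
        (∀ i, σ i ^ (2 * (N + 2) - 1)
            - Real.sqrt (∏ l, lam l) * y (π (Fin.castLE (dMin_le_dY d) i)) * σ i ^ ((N + 2) - 1)
            + (∏ l, lam l) * σ i = 0) ∧
        Antitone σ ∧ (∀ i, 0 ≤ σ i) ∧
        W 0 = (Q (Fin.succ 0)).1 * sigmaMat (lam 0) σ (Fin.succ 0) 0
            * blkD₂ (dY_le_zero d) (dY_le_zero d) (π.permMatrix ℝ) 1
            * blkD₂ (rank_le_cols Y) (rank_le_cols Y) (blkD hs.sum_mult fun k => (O k).1) O'.1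
            * Vᵀ ∧
        (∀ l : Fin (N + 2), l ≠ 0 → l ≠ Fin.last (N + 1) →
          W l = (Q l.succ).1 * sigmaMat (lam l) σ l.succ l.castSucc * (Q l.castSucc).1ᵀ) ∧
        W (Fin.last (N + 1)) =
          U * blkD₂ (rank_le_rows Y) (rank_le_rows Y) (blkD hs.sum_mult fun k => (O k).1ᵀ) Ohat.1ᵀ
            * blkD₂ (dY_le_last d) (dY_le_last d) (π.permMatrix ℝ)ᵀ 1
            * sigmaMat (lam (Fin.last (N + 1))) σ (Fin.last (N + 2)) (Fin.last (N + 1)).castSucc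
            * (Q (Fin.last (N + 1)).castSucc).1ᵀ := by
  rw [isCriticalPoint_iff_exists_factorization hlam]
  constructor
  · rintro ⟨Q, t, z, ht, ht0, htn, hz, hW, hYz, hpoly⟩
    have hYz' : Y = (Q (Fin.last (N + 2))).1 * blkD₂ (dY_le_last d) (dY_le_zero d)
        (Matrix.diagonal fun i => z i) 0 * (Q 0).1ᵀ := by
      rw [blkD₂_zero_eq_rdiag, rdiag_congr (g := z)]
      · exact hYz
      · exact fun i h h' => dif_pos (lt_min h' h)
    obtain ⟨π, hπ⟩ := exists_perm_of_svd_eq (dY_le_last d) (dY_le_zero d)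
      (U := ⟨U, hY.left_orthogonal⟩) (V := ⟨V, hY.right_orthogonal⟩) (fun i => hz i) hY.nonneg
      (hYz'.symm.trans hY.eq)
    simp only [hπ] at hYz'
    obtain ⟨O, O', Ohat, hR, hP⟩ := (hY.eq_iff_exists_blocks hs _ _ π).1 hYz'
    refine ⟨Q, O, O', Ohat, fun i => t i, π, ?_, fun i j hij => ht hij, fun i => ht0 i, ?_, ?_, ?_⟩
    · intro i
      rw [← hπ]
      exact hpoly i
    · refine (hW 0).trans ?_
      rw [sigmaMat_restrict htn]
      change (Q (Fin.succ 0)).1 * rdiag (d (Fin.succ 0)) (d 0) _ * (Q 0).1ᵀ = _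
      rw [hR]
      simp only [← Matrix.mul_assoc]
    · intro l _ _
      rw [sigmaMat_restrict htn]
      exact hW l
    · refine (hW (Fin.last (N + 1))).trans ?_
      rw [sigmaMat_restrict htn, ← hP]
      rfl
  · rintro ⟨Q, O, O', Ohat, σ, π, hpoly, hσ, hσ0, hW0, hW, hWL⟩
    -- Zero padding keeps `t` decreasing and makes the scalar equation trivial beyond d_min,
    -- whatever `z` is there.
    let t : ℕ → ℝ := fun i => if h : i < dMin d then σ ⟨i, h⟩ else 0
    let z : ℕ → ℝ := fun i => if h : i < dY d then y (π ⟨i, h⟩) else 0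
    have hsig : ∀ c k j, sigmaMat c σ k j = rdiag (d k) (d j) fun i => t i / √c :=
      sigmaMat_eq_rdiag (σ := σ)
    have hB : blkD₂ (rank_le_cols Y) (rank_le_cols Y) (blkD hs.sum_mult fun k => (O k).1) O'.1 ∈
        Matrix.orthogonalGroup (Fin (d 0)) ℝ := (blkD₂_mem_orthogonalGroup_iff _ _ _).2
      ⟨(blkD_mem_orthogonalGroup_iff _ _).2 fun k => (O k).2, O'.2⟩
    have hE : blkD₂ (rank_le_rows Y) (rank_le_rows Y) (blkD hs.sum_mult fun k => (O k).1ᵀ)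
        Ohat.1ᵀ ∈ Matrix.orthogonalGroup (Fin (d (Fin.last (N + 2)))) ℝ :=
      (blkD₂_mem_orthogonalGroup_iff _ _ _).2
        ⟨(blkD_mem_orthogonalGroup_iff _ _).2 fun k => (orthTranspose (O k)).2,
          (orthTranspose Ohat).2⟩
    -- The outer frames do not occur in the formulas, so they may be replaced by the ones read off
    -- from the first and last weights.
    obtain ⟨Q', hQ0, hQL, hQ⟩ := exists_fin_update_ends Q
      (orthTranspose (permBlock (dY_le_zero d) π * ⟨_, hB⟩ *
        orthTranspose ⟨V, hY.right_orthogonal⟩))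
      (⟨U, hY.left_orthogonal⟩ * ⟨_, hE⟩ * orthTranspose (permBlock (dY_le_last d) π))
    have hR : (Q' 0).1ᵀ = blkD₂ (dY_le_zero d) (dY_le_zero d) (π.permMatrix ℝ) 1
        * blkD₂ (rank_le_cols Y) (rank_le_cols Y) (blkD hs.sum_mult fun k => (O k).1) O'.1
        * Vᵀ := by
      rw [hQ0]
      exact transpose_transpose _
    have hP : (Q' (Fin.last (N + 2))).1 =
        U * blkD₂ (rank_le_rows Y) (rank_le_rows Y) (blkD hs.sum_mult fun k => (O k).1ᵀ) Ohat.1ᵀ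
          * blkD₂ (dY_le_last d) (dY_le_last d) (π.permMatrix ℝ)ᵀ 1 := by
      have : (permBlock (dY_le_last d) π).1ᵀ =
          blkD₂ (dY_le_last d) (dY_le_last d) (π.permMatrix ℝ)ᵀ 1 := by
        rw [permBlock, blkD₂_transpose, transpose_one]
      rw [hQL, ← this]
      rfl
    refine ⟨Q', t, z, ?_, ?_, ?_, ?_, ?_, ?_, ?_⟩
    · intro i j hij
      simp only [t]
      split_ifs with hj hi
      · exact hσ hij
      · omega
      · exact hσ0 _
      · rfl
    · intro i
      simp only [t]
      split_ifs
      · exact hσ0 _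
      · rfl
    · exact fun k i hi => dif_neg (not_lt.2 ((dMin_le d k).trans hi))
    · intro i
      simp only [z]
      split_ifs
      · exact hY.nonneg _
      · rfl
    · intro l
      rw [← hsig]
      by_cases h0 : l = 0
      · subst h0
        rw [hQ (Fin.succ 0) (Fin.succ_ne_zero _) (by simp [Fin.ext_iff])]
        refine hW0.trans ?_
        change _ = (Q (Fin.succ 0)).1 * sigmaMat (lam 0) σ (Fin.succ 0) 0 * (Q' 0).1ᵀ
        rw [hR]
        simp only [← Matrix.mul_assoc]
      · have h0' : l.castSucc ≠ 0 := fun h => h0 (by simpa using h)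
        rw [hQ l.castSucc h0' (Fin.castSucc_ne_last l)]
        by_cases h1 : l = Fin.last (N + 1)
        · subst h1
          refine hWL.trans ?_
          rw [← hP]
          rfl
        · rw [hQ l.succ (Fin.succ_ne_zero _) fun h => h1 (by simpa using h)]
          exact hW l h0 h1
    · rw [← blkD₂_zero_eq_rdiag (dY_le_last d) (dY_le_zero d) fun i => y (π i)]
      exact (hY.eq_iff_exists_blocks hs _ _ π).2 ⟨O, O', Ohat, hR, hP⟩
    · intro i
      by_cases hi : i < dMin d
      · have := hpoly ⟨i, hi⟩
        simp only [t, z]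
        rw [dif_pos hi, dif_pos (hi.trans_le (dMin_le_dY d))]
        exact this
      · simp only [t]
        rw [dif_neg hi, zero_pow (by omega), zero_pow (by omega)]
        ring
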